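/- Let $n\ge 1$ and let $\nabla$ be a smooth metric connection on a Euclidean vector bundle of rank $r$ over $\mathbb R^n$; in a global orthonormal frame write $\nabla_i=\partial_i+\Gamma_i$ with $\Gamma_i:\mathbb R^n\to\mathfrak{so}(r)$ smooth. Let $F_{ij}=\partial_i\Gamma_j-\partial_j\Gamma_i+[\Gamma_i,\Gamma_j]$ be its curvature, $|F|^2=-\sum_{i,j}\operatorname{tr}(F_{ij}F_{ij})$, $(v\lrcorner F)_j=\sum_i v^iF_{ij}$ and $(D^*F)_j=-\sum_i(\partial_iF_{ij}+[\Gamma_i,F_{ij}])$. For $x_0\in\mathbb R^n$ and $t_0>0$ put $$\mathcal F_{x_0,t_0}(\nabla)=t_0^2(4\pi t_0)^{-n/2}\int_{\mathbb R^n}|F|^2e^{-\frac{|x-x_0|^2}{4t_0}}\,dx\in[0,\infty],\qquad \lambda(\nabla)=\sup_{x_0\in\mathbb R^n,\;t_0>0}\mathcal F_{x_0,t_0}(\nabla).$$ Suppose that 1. $\nabla$ is a soliton ($\nabla\in\mathfrak S$): $D^*F+\frac x2\lrcorner F=0$ on $\mathbb R^n$; 2. $\nabla$ has polynomial energy growth: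 there are $y\in\mathbb R^n$ and a polynomial $p$ with $\int_{B_y(\rho)}|F|^2\,dx\le p(\rho)$ for all $\rho>0$; 3. $\nabla$ is not cylindrical: there is no constant vector $V\neq0$ with $V\lrcorner F\equiv0$. Then $\lambda(\nabla)<\infty$, and for every $\varepsilon>0$ there is $\delta>0$ such that $$\sup\{\mathcal F_{x_0,t_0}(\nabla): x_0\in\mathbb R^n,\ t_0>0,\ |x_0|+|\log t_0|>\varepsilon\}<\lambda(\nabla)-\delta .$$ In particular, the entropy is attained exactly at $(0,1)$: for $x_0\in\mathbb R^n$ and $t_0>0$ one has $\mathcal F_{x_0,t_0}(\nabla)=\lambda(\nabla)$ if and only if $(x_0,t_0)=(0,1)$. -/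

import Mathlib

open scoped ContDiff ENNReal

noncomputable section

namespace YangMills

/-- The partial derivative `∂ᵢ A` of a matrix-valued function on `ℝⁿ`, taken entrywise. -/
def partialDeriv {n r : ℕ} (i : Fin n)
    (A : EuclideanSpace ℝ (Fin n) → Matrix (Fin r) (Fin r) ℝ)
    (x : EuclideanSpace ℝ (Fin n)) : Matrix (Fin r) (Fin r) ℝ :=
  Matrix.of fun α β => fderiv ℝ (fun y => A y α β) x (EuclideanSpace.single i 1)

/-- A smooth metric connection `∇ = d + Γ` on a Euclidean vector bundle of rank `r` over `ℝⁿ`, given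
by its connection coefficients in a global orthonormal frame: `∇ᵢ σ = ∂ᵢ σ + Γᵢ σ` for a section
`σ : ℝⁿ → ℝʳ`. The matrix `Γᵢ` has the entry `Γ_{iα}^β` in row `β` and column `α`; compatibility
with the bundle metric says that it is skew-symmetric. -/
structure MetricConnection (n r : ℕ) where
  /-- The coefficient matrices `Γᵢ(x)`. -/
  coeff : Fin n → EuclideanSpace ℝ (Fin n) → Matrix (Fin r) (Fin r) ℝ
  smooth : ∀ i α β, ContDiff ℝ ∞ fun x => coeff i x α β
  skew : ∀ i x, (coeff i x).transpose = -coeff i x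

namespace MetricConnection

variable {n r : ℕ} (D : MetricConnection n r)

/-- The curvature `Fᵢⱼ = ∂ᵢΓⱼ - ∂ⱼΓᵢ + ΓᵢΓⱼ - ΓⱼΓᵢ`, an `End(E)`-valued two-form. -/
def curvature (i j : Fin n) (x : EuclideanSpace ℝ (Fin n)) : Matrix (Fin r) (Fin r) ℝ :=
  partialDeriv i (D.coeff j) x - partialDeriv j (D.coeff i) x
    + D.coeff i x * D.coeff j x - D.coeff j x * D.coeff i x

/-- The covariant derivative `∇ᵢ A = ∂ᵢ A + [Γᵢ, A]` of a section `A` of `End(E)`. As `ℝⁿ` is flat,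
the covariant derivative of an `End(E)`-valued form is computed componentwise by it. -/
def covDerivEnd (i : Fin n) (A : EuclideanSpace ℝ (Fin n) → Matrix (Fin r) (Fin r) ℝ)
    (x : EuclideanSpace ℝ (Fin n)) : Matrix (Fin r) (Fin r) ℝ :=
  partialDeriv i A x + D.coeff i x * A x - A x * D.coeff i x

/-- `(D^* F)ⱼ = -∑ᵢ ∇ᵢ Fᵢⱼ`, where `D^* = ∇^*`. -/
def codiffCurvature (j : Fin n) (x : EuclideanSpace ℝ (Fin n)) : Matrix (Fin r) (Fin r) ℝ :=
  -∑ i, D.covDerivEnd i (D.curvature i j) x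

/-- The contraction `(v ⌟ F)ⱼ = ∑ᵢ vᵢ Fᵢⱼ` at the point `x`. -/
def contractCurvature (v : EuclideanSpace ℝ (Fin n)) (j : Fin n)
    (x : EuclideanSpace ℝ (Fin n)) : Matrix (Fin r) (Fin r) ℝ :=
  ∑ i, v i • D.curvature i j x

/-- `|F|² = ∑ᵢⱼ |Fᵢⱼ|² = ∑ᵢⱼ tr(Fᵢⱼᵀ Fᵢⱼ)`, which is `-∑ᵢⱼ tr(Fᵢⱼ Fᵢⱼ)` as `Fᵢⱼ` is skew. -/
def curvatureNormSq (x : EuclideanSpace ℝ (Fin n)) : ℝ :=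
  ∑ i, ∑ j, ((D.curvature i j x).transpose * D.curvature i j x).trace

/-- `∇` is a (shrinking) soliton: `D^* F + (x / 2) ⌟ F = 0`. -/
def IsSoliton : Prop :=
  ∀ (x : EuclideanSpace ℝ (Fin n)) (j : Fin n),
    D.codiffCurvature j x + (1 / 2 : ℝ) • D.contractCurvature x j x = 0

/-- `∇` is cylindrical: `V ⌟ F ≡ 0` for some nonzero constant vector field `V`. -/
def IsCylindrical : Prop :=
  ∃ V : EuclideanSpace ℝ (Fin n), V ≠ 0 ∧
    ∀ (x : EuclideanSpace ℝ (Fin n)) (j : Fin n), D.contractCurvature V j x = 0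

/-- Polynomial energy growth about `y`. -/
def HasPolynomialEnergyGrowthAbout (y : EuclideanSpace ℝ (Fin n)) : Prop :=
  ∃ p : Polynomial ℝ, ∀ ρ : ℝ, 0 < ρ →
    ∫ x in Metric.ball y ρ, D.curvatureNormSq x ≤ p.eval ρ

/-- Polynomial energy growth (about some point; equivalently, about every point). -/
def HasPolynomialEnergyGrowth : Prop :=
  ∃ y : EuclideanSpace ℝ (Fin n), D.HasPolynomialEnergyGrowthAbout y

/-- `F_{x₀,t₀}(∇) = t₀² ∫ |F|² (4πt₀)^{-n/2} exp(-|x - x₀|² / (4t₀)) dx`, with values in `[0, ∞]`;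
it is used for `t₀ > 0` only. -/
def functional (x₀ : EuclideanSpace ℝ (Fin n)) (t₀ : ℝ) : ℝ≥0∞ :=
  ENNReal.ofReal (t₀ ^ 2) * ∫⁻ x : EuclideanSpace ℝ (Fin n),
    ENNReal.ofReal (D.curvatureNormSq x *
      ((4 * Real.pi * t₀) ^ (-(n : ℝ) / 2) * Real.exp (-‖x - x₀‖ ^ 2 / (4 * t₀))))

/-- The entropy `λ(∇)`, the supremum of `F_{x₀,t₀}(∇)` over `x₀ ∈ ℝⁿ` and `t₀ > 0`. -/
def entropy : ℝ≥0∞ :=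
  sSup {a : ℝ≥0∞ | ∃ (x₀ : EuclideanSpace ℝ (Fin n)) (t₀ : ℝ), 0 < t₀ ∧ a = D.functional x₀ t₀}

end MetricConnection

end YangMills

end

/-! Write `S` for the form `S(u, v) = ⟨u ⌟ F, v ⌟ F⟩`. The Bianchi identity and the soliton equation
give `div S = ¼ ∇|F|² + ½ S(x, ·)` (`IsSoliton.sum_fderiv_stress`). Testing this against a vector
field and integrating by parts yields a first variation formula. Polynomial energy growth makes
`|F|²` integrable against every Gaussian times a polynomial, so a cutoff argument extends the
formula to Gaussian-weighted linear fields (`IsSoliton.integral_stressPairing`,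
`IsSoliton.integral_heatKernel`).

Join `(0, 1)` to `(x₀, t₀)` by the path `s ↦ (s y, t)` with `t = 1 + a s²`, `y = x₀`, `a = t₀ - 1`.
Put `z = x - s y` and `X = y + (a s / t) z`. Then `x = z / t + s X`, so in the first variation
formula for the heat kernel times `X` the mixed terms `S(z, X)` cancel. What remains says that the
derivative of the functional along the path is `-2 s t² ∫ S(X, X)` against the heat kernel, which is
at most zero (`IsSoliton.hasDerivAt_realFunctional_path`).

If this integral vanishes at some `s` in `(0, 1)`, then `X ⌟ F ≡ 0`. A constant nonzero `X` makes
the connection cylindrical by definition. Otherwise the divergence identity makes `|F|²` homogeneous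
of degree `-4` about the zero of `X`; smoothness there forces `F = 0`, which is cylindrical too as
`n ≥ 1` (`IsSoliton.isCylindrical_of_stressForm_eq_zero`). Hence the functional decreases strictly
along every nontrivial path.

The uniform gap comes from compactness of the sphere `‖x₀‖ + |log t₀| = ε`: a path ending outside it
crosses it, and the value at the end is at most the value at the crossing. -/

noncomputable section

namespace YangMills

variable {n r : ℕ}

/-! ### Entrywise calculus of matrix-valued functions. -/

section PartialDeriv

variable {A B : EuclideanSpace ℝ (Fin n) → Matrix (Fin r) (Fin r) ℝ}

/-- A matrix-valued function all of whose entries are smooth. -/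
def SmoothEntries (A : EuclideanSpace ℝ (Fin n) → Matrix (Fin r) (Fin r) ℝ) : Prop :=
  ∀ α β, ContDiff ℝ ∞ fun x => A x α β

lemma SmoothEntries.differentiableAt (hA : SmoothEntries A) (α β : Fin r)
    (x : EuclideanSpace ℝ (Fin n)) : DifferentiableAt ℝ (fun y => A y α β) x :=
  ((hA α β).differentiable (by simp)) x

lemma SmoothEntries.add (hA : SmoothEntries A) (hB : SmoothEntries B) :
    SmoothEntries fun x => A x + B x := fun α β => (hA α β).add (hB α β)

lemma SmoothEntries.sub (hA : SmoothEntries A) (hB : SmoothEntries B) :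
    SmoothEntries fun x => A x - B x := fun α β => (hA α β).sub (hB α β)

lemma SmoothEntries.mul (hA : SmoothEntries A) (hB : SmoothEntries B) :
    SmoothEntries fun x => A x * B x := fun α β => by
  simp only [Matrix.mul_apply]
  exact ContDiff.sum fun γ _ => (hA α γ).mul (hB γ β)

lemma SmoothEntries.partialDeriv (hA : SmoothEntries A) (i : Fin n) :
    SmoothEntries (YangMills.partialDeriv i A) := fun α β =>
  ((hA α β).fderiv_right (m := ∞) (by simp)).clm_apply contDiff_const

lemma partialDeriv_add (hA : SmoothEntries A) (hB : SmoothEntries B) (i : Fin n)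
    (x : EuclideanSpace ℝ (Fin n)) :
    partialDeriv i (fun y => A y + B y) x = partialDeriv i A x + partialDeriv i B x := by
  ext α β
  simp only [partialDeriv, Matrix.of_apply, Matrix.add_apply]
  rw [fderiv_fun_add (hA.differentiableAt α β x) (hB.differentiableAt α β x)]
  rfl

lemma partialDeriv_sub (hA : SmoothEntries A) (hB : SmoothEntries B) (i : Fin n)
    (x : EuclideanSpace ℝ (Fin n)) :
    partialDeriv i (fun y => A y - B y) x = partialDeriv i A x - partialDeriv i B x := by
  ext α β
  simp only [partialDeriv, Matrix.of_apply, Matrix.sub_apply]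
  rw [fderiv_fun_sub (hA.differentiableAt α β x) (hB.differentiableAt α β x)]
  rfl

lemma partialDeriv_neg (i : Fin n) (x : EuclideanSpace ℝ (Fin n)) :
    partialDeriv i (fun y => -A y) x = -partialDeriv i A x := by
  ext α β
  simp only [partialDeriv, Matrix.of_apply, Matrix.neg_apply]
  rw [fderiv_fun_neg]
  rfl

lemma partialDeriv_mul (hA : SmoothEntries A) (hB : SmoothEntries B) (i : Fin n)
    (x : EuclideanSpace ℝ (Fin n)) :
    partialDeriv i (fun y => A y * B y) x = partialDeriv i A x * B x + A x * partialDeriv i B x := by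
  ext α β
  simp only [partialDeriv, Matrix.of_apply, Matrix.add_apply, Matrix.mul_apply]
  rw [fderiv_fun_sum fun γ _ => (hA.differentiableAt α γ x).fun_mul (hB.differentiableAt γ β x),
    _root_.sum_apply, ← Finset.sum_add_distrib]
  refine Finset.sum_congr rfl fun γ _ => ?_
  rw [fderiv_fun_mul (hA.differentiableAt α γ x) (hB.differentiableAt γ β x)]
  simp only [add_apply, smul_apply, smul_eq_mul]
  ring

lemma partialDeriv_comm (hA : SmoothEntries A) (i j : Fin n) (x : EuclideanSpace ℝ (Fin n)) :
    partialDeriv i (partialDeriv j A) x = partialDeriv j (partialDeriv i A) x := by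
  ext α β
  simp only [partialDeriv, Matrix.of_apply]
  have hd : DifferentiableAt ℝ (fderiv ℝ fun y => A y α β) x :=
    (((hA α β).fderiv_right (m := 1) (by norm_cast)).differentiable (by simp)) x
  rw [fderiv_clm_apply hd (differentiableAt_const _), fderiv_clm_apply hd (differentiableAt_const _)]
  have hs : IsSymmSndFDerivAt ℝ (fun y => A y α β) x :=
    ((hA α β).contDiffAt).isSymmSndFDerivAt (by simp; norm_cast)
  simpa using hs.eq (EuclideanSpace.single i 1) (EuclideanSpace.single j 1)

lemma trace_transpose_mul (A B : Matrix (Fin r) (Fin r) ℝ) :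
    (A.transpose * B).trace = ∑ α, ∑ β, A α β * B α β := by
  simp only [Matrix.trace, Matrix.diag_apply, Matrix.mul_apply, Matrix.transpose_apply]
  exact Finset.sum_comm

lemma SmoothEntries.trace_transpose_mul (hA : SmoothEntries A) (hB : SmoothEntries B) :
    ContDiff ℝ ∞ fun x => ((A x).transpose * B x).trace := by
  simp only [YangMills.trace_transpose_mul]
  exact ContDiff.sum fun α _ => ContDiff.sum fun β _ => (hA α β).mul (hB α β)

lemma fderiv_trace_transpose_mul (hA : SmoothEntries A) (hB : SmoothEntries B) (i : Fin n)
    (x : EuclideanSpace ℝ (Fin n)) :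
    fderiv ℝ (fun y => ((A y).transpose * B y).trace) x (EuclideanSpace.single i 1)
      = ((partialDeriv i A x).transpose * B x).trace
        + ((A x).transpose * partialDeriv i B x).trace := by
  simp only [trace_transpose_mul]
  have hm : ∀ α β, DifferentiableAt ℝ (fun y => A y α β * B y α β) x := fun α β =>
    (hA.differentiableAt α β x).mul (hB.differentiableAt α β x)
  rw [fderiv_fun_sum fun α _ => DifferentiableAt.fun_sum fun β _ => hm α β,
    _root_.sum_apply, ← Finset.sum_add_distrib]
  refine Finset.sum_congr rfl fun α _ => ?_
  rw [fderiv_fun_sum fun β _ => hm α β, _root_.sum_apply, ← Finset.sum_add_distrib]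
  refine Finset.sum_congr rfl fun β _ => ?_
  rw [fderiv_fun_mul (hA.differentiableAt α β x) (hB.differentiableAt α β x)]
  simp only [add_apply, smul_apply, smul_eq_mul,
    partialDeriv, Matrix.of_apply]
  ring

end PartialDeriv

/-! ### The Bianchi identity and the divergence of the stress tensor. -/

namespace MetricConnection

variable (D : MetricConnection n r)

lemma smoothEntries_coeff (i : Fin n) : SmoothEntries (D.coeff i) := D.smooth i

lemma smoothEntries_curvature (i j : Fin n) : SmoothEntries (D.curvature i j) :=
  (((((D.smoothEntries_coeff j).partialDeriv i).sub ((D.smoothEntries_coeff i).partialDeriv j)).add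
    ((D.smoothEntries_coeff i).mul (D.smoothEntries_coeff j))).sub
    ((D.smoothEntries_coeff j).mul (D.smoothEntries_coeff i)))

lemma curvature_swap (i j : Fin n) (x : EuclideanSpace ℝ (Fin n)) :
    D.curvature j i x = -D.curvature i j x := by
  simp only [curvature]
  abel

lemma partialDeriv_curvature (i j k : Fin n) (x : EuclideanSpace ℝ (Fin n)) :
    partialDeriv k (D.curvature i j) x =
      partialDeriv k (partialDeriv i (D.coeff j)) x - partialDeriv k (partialDeriv j (D.coeff i)) x
      + (partialDeriv k (D.coeff i) x * D.coeff j x + D.coeff i x * partialDeriv k (D.coeff j) x)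
      - (partialDeriv k (D.coeff j) x * D.coeff i x
        + D.coeff j x * partialDeriv k (D.coeff i) x) := by
  have hi := D.smoothEntries_coeff i
  have hj := D.smoothEntries_coeff j
  have h : D.curvature i j = fun y => partialDeriv i (D.coeff j) y - partialDeriv j (D.coeff i) y
    + D.coeff i y * D.coeff j y - D.coeff j y * D.coeff i y := rfl
  rw [h, partialDeriv_sub (((hj.partialDeriv i).sub (hi.partialDeriv j)).add (hi.mul hj))
    (hj.mul hi), partialDeriv_add ((hj.partialDeriv i).sub (hi.partialDeriv j)) (hi.mul hj),
    partialDeriv_sub (hj.partialDeriv i) (hi.partialDeriv j), partialDeriv_mul hi hj,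
    partialDeriv_mul hj hi]

/-- The second Bianchi identity. -/
theorem bianchi (i j k : Fin n) (x : EuclideanSpace ℝ (Fin n)) :
    D.covDerivEnd i (D.curvature j k) x + D.covDerivEnd j (D.curvature k i) x
      + D.covDerivEnd k (D.curvature i j) x = 0 := by
  simp only [covDerivEnd, partialDeriv_curvature]
  rw [partialDeriv_comm (D.smoothEntries_coeff k) i j, partialDeriv_comm (D.smoothEntries_coeff j) i k,
    partialDeriv_comm (D.smoothEntries_coeff i) j k]
  simp only [curvature]
  noncomm_ring

lemma covDerivEnd_curvature_swap (i j k : Fin n) (x : EuclideanSpace ℝ (Fin n)) :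
    D.covDerivEnd k (D.curvature j i) x = -D.covDerivEnd k (D.curvature i j) x := by
  have h : D.curvature j i = fun y => -D.curvature i j y := funext fun y => D.curvature_swap i j y
  rw [h]
  simp only [covDerivEnd, partialDeriv_neg]
  noncomm_ring

/-- The connection on `End(E)` is compatible with the trace inner product. -/
lemma fderiv_trace_eq_covDerivEnd {A B : EuclideanSpace ℝ (Fin n) → Matrix (Fin r) (Fin r) ℝ}
    (hA : SmoothEntries A) (hB : SmoothEntries B) (i : Fin n) (x : EuclideanSpace ℝ (Fin n)) :
    fderiv ℝ (fun y => ((A y).transpose * B y).trace) x (EuclideanSpace.single i 1)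
      = ((D.covDerivEnd i A x).transpose * B x).trace
        + ((A x).transpose * D.covDerivEnd i B x).trace := by
  rw [fderiv_trace_transpose_mul hA hB]
  simp only [covDerivEnd, Matrix.transpose_add, Matrix.transpose_sub, Matrix.transpose_mul,
    D.skew, add_mul, sub_mul, mul_add, mul_sub, Matrix.trace_add, Matrix.trace_sub,
    Matrix.mul_neg, Matrix.neg_mul, Matrix.trace_neg]
  have h : (D.coeff i x * (A x).transpose * B x).trace
      = ((A x).transpose * (B x * D.coeff i x)).trace := by
    rw [Matrix.mul_assoc, Matrix.trace_mul_comm, Matrix.mul_assoc]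
  rw [h, Matrix.mul_assoc]
  ring

/-- `Sᵢⱼ = ∑ₖ ⟨Fᵢₖ, Fⱼₖ⟩`. -/
def stress (i j : Fin n) (x : EuclideanSpace ℝ (Fin n)) : ℝ :=
  ∑ k, ((D.curvature i k x).transpose * D.curvature j k x).trace

lemma contDiff_stress (i j : Fin n) : ContDiff ℝ ∞ (D.stress i j) :=
  ContDiff.sum fun k _ =>
    (D.smoothEntries_curvature i k).trace_transpose_mul (D.smoothEntries_curvature j k)

lemma curvatureNormSq_eq_sum_stress (x : EuclideanSpace ℝ (Fin n)) :
    D.curvatureNormSq x = ∑ i, D.stress i i x := rfl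

lemma contDiff_curvatureNormSq : ContDiff ℝ ∞ D.curvatureNormSq :=
  ContDiff.sum fun i _ => D.contDiff_stress i i

lemma fderiv_stress (i j k : Fin n) (x : EuclideanSpace ℝ (Fin n)) :
    fderiv ℝ (D.stress i j) x (EuclideanSpace.single k 1) =
      ∑ l, (((D.covDerivEnd k (D.curvature i l) x).transpose * D.curvature j l x).trace
        + ((D.curvature i l x).transpose * D.covDerivEnd k (D.curvature j l) x).trace) := by
  have h : D.stress i j = fun y => ∑ l, ((D.curvature i l y).transpose * D.curvature j l y).trace :=
    rfl
  rw [h, fderiv_fun_sum fun l _ => (((D.smoothEntries_curvature i l).trace_transpose_mul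
    (D.smoothEntries_curvature j l)).differentiable (by simp)) x, _root_.sum_apply]
  exact Finset.sum_congr rfl fun l _ => D.fderiv_trace_eq_covDerivEnd
    (D.smoothEntries_curvature i l) (D.smoothEntries_curvature j l) k x

lemma trace_transpose_mul_comm (A B : Matrix (Fin r) (Fin r) ℝ) :
    (A.transpose * B).trace = (B.transpose * A).trace := by
  simp only [trace_transpose_mul, mul_comm]

lemma fderiv_curvatureNormSq (j : Fin n) (x : EuclideanSpace ℝ (Fin n)) :
    fderiv ℝ D.curvatureNormSq x (EuclideanSpace.single j 1) =
      2 * ∑ i, ∑ k, ((D.curvature i k x).transpose * D.covDerivEnd j (D.curvature i k) x).trace := by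
  have h : D.curvatureNormSq = fun y => ∑ i, D.stress i i y := rfl
  rw [h, fderiv_fun_sum fun i _ => ((D.contDiff_stress i i).differentiable (by simp)) x,
    _root_.sum_apply, Finset.mul_sum]
  refine Finset.sum_congr rfl fun i _ => ?_
  rw [fderiv_stress, Finset.mul_sum]
  refine Finset.sum_congr rfl fun k _ => ?_
  rw [trace_transpose_mul_comm (D.covDerivEnd j (D.curvature i k) x)]
  ring

/-- The part of the divergence of the stress tensor which the Bianchi identity computes. -/
lemma sum_trace_curvature_covDerivEnd (j : Fin n) (x : EuclideanSpace ℝ (Fin n)) :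
    ∑ i, ∑ k, ((D.curvature i k x).transpose * D.covDerivEnd i (D.curvature j k) x).trace
      = 1 / 4 * fderiv ℝ D.curvatureNormSq x (EuclideanSpace.single j 1) := by
  rw [fderiv_curvatureNormSq]
  -- Exchanging `i` and `k` changes two signs, so these sums agree. By Bianchi (`h2`) they add up to
  -- half of `∂ⱼ|F|²`; each is therefore a quarter of it.
  have h1 : ∑ i, ∑ k, ((D.curvature i k x).transpose * D.covDerivEnd i (D.curvature j k) x).trace
      = ∑ i, ∑ k, ((D.curvature i k x).transpose * D.covDerivEnd k (D.curvature i j) x).trace := by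
    rw [Finset.sum_comm]
    refine Finset.sum_congr rfl fun i _ => Finset.sum_congr rfl fun k _ => ?_
    rw [D.curvature_swap i k, D.covDerivEnd_curvature_swap i j]
    simp
  have h2 : ∑ i, ∑ k, ((D.curvature i k x).transpose * D.covDerivEnd i (D.curvature j k) x).trace
      + ∑ i, ∑ k, ((D.curvature i k x).transpose * D.covDerivEnd k (D.curvature i j) x).trace
      = ∑ i, ∑ k, ((D.curvature i k x).transpose * D.covDerivEnd j (D.curvature i k) x).trace := by
    simp only [← Finset.sum_add_distrib]
    refine Finset.sum_congr rfl fun i _ => Finset.sum_congr rfl fun k _ => ?_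
    rw [← Matrix.trace_add, ← Matrix.mul_add]
    have hb := D.bianchi i j k x
    rw [D.covDerivEnd_curvature_swap i k j] at hb
    have : D.covDerivEnd i (D.curvature j k) x + D.covDerivEnd k (D.curvature i j) x
        = D.covDerivEnd j (D.curvature i k) x := by
      rw [← sub_eq_zero, ← hb]; abel
    rw [this]
  linarith

/-- The divergence of the stress-energy tensor `S - |F|² / 4` of a soliton. -/
theorem IsSoliton.sum_fderiv_stress {D : MetricConnection n r} (hD : D.IsSoliton) (j : Fin n)
    (x : EuclideanSpace ℝ (Fin n)) :
    ∑ i, fderiv ℝ (D.stress i j) x (EuclideanSpace.single i 1)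
      = 1 / 4 * fderiv ℝ D.curvatureNormSq x (EuclideanSpace.single j 1)
        + 1 / 2 * ∑ l, x l * D.stress l j x := by
  simp only [fderiv_stress, Finset.sum_add_distrib]
  rw [D.sum_trace_curvature_covDerivEnd, add_comm, add_right_inj, Finset.sum_comm]
  have h : ∀ k, ∑ i, D.covDerivEnd i (D.curvature i k) x
      = (1 / 2 : ℝ) • D.contractCurvature x k x := fun k => by
    have := hD x k
    rw [codiffCurvature] at this
    exact (neg_add_eq_zero.mp this)
  have h' : ∀ k, ∑ i, ((D.covDerivEnd i (D.curvature i k) x).transpose * D.curvature j k x).trace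
      = 1 / 2 * ∑ l, x l * ((D.curvature l k x).transpose * D.curvature j k x).trace := fun k => by
    rw [← Matrix.trace_sum, ← Matrix.sum_mul, ← Matrix.transpose_sum, h k, contractCurvature]
    simp [Matrix.transpose_sum, Matrix.sum_mul, Matrix.trace_sum]
  simp only [h', stress, ← Finset.mul_sum]
  rw [Finset.sum_comm]
  simp only [Finset.mul_sum]

/-! ### Positivity and size of the stress form. -/

/-- The quadratic form `S(u, v) = ∑ᵢⱼ Sᵢⱼ uᵢ vⱼ`. -/
def stressForm (x u v : EuclideanSpace ℝ (Fin n)) : ℝ :=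
  ∑ i, ∑ j, D.stress i j x * u i * v j

lemma stressForm_add_left (x u u' v : EuclideanSpace ℝ (Fin n)) :
    D.stressForm x (u + u') v = D.stressForm x u v + D.stressForm x u' v := by
  simp only [stressForm, ← Finset.sum_add_distrib, PiLp.add_apply]
  exact Finset.sum_congr rfl fun i _ => Finset.sum_congr rfl fun j _ => by ring

lemma stressForm_smul_left (c : ℝ) (x u v : EuclideanSpace ℝ (Fin n)) :
    D.stressForm x (c • u) v = c * D.stressForm x u v := by
  simp only [stressForm, Finset.mul_sum, PiLp.smul_apply, smul_eq_mul]
  exact Finset.sum_congr rfl fun i _ => Finset.sum_congr rfl fun j _ => by ring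

lemma stressForm_smul_right (c : ℝ) (x u v : EuclideanSpace ℝ (Fin n)) :
    D.stressForm x u (c • v) = c * D.stressForm x u v := by
  simp only [stressForm, Finset.mul_sum, PiLp.smul_apply, smul_eq_mul]
  exact Finset.sum_congr rfl fun i _ => Finset.sum_congr rfl fun j _ => by ring

/-- The Gram form of the linear map `u ↦ u ⌟ F`: this makes it positive semidefinite and identifies
its null vectors with those annihilating `F`. -/
lemma stressForm_eq_sum_trace (x u v : EuclideanSpace ℝ (Fin n)) :
    D.stressForm x u v
      = ∑ k, ((D.contractCurvature u k x).transpose * D.contractCurvature v k x).trace := by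
  have h : ∀ k, ((D.contractCurvature u k x).transpose * D.contractCurvature v k x).trace
      = ∑ i, ∑ j, ((D.curvature i k x).transpose * D.curvature j k x).trace * u i * v j := fun k => by
    simp only [contractCurvature, Matrix.transpose_sum, Matrix.sum_mul, Matrix.trace_sum]
    refine Finset.sum_congr rfl fun i _ => ?_
    simp only [Matrix.mul_sum, Matrix.trace_sum]
    refine Finset.sum_congr rfl fun j _ => ?_
    simp only [Matrix.transpose_smul, Matrix.smul_mul, Matrix.mul_smul, Matrix.trace_smul,
      smul_eq_mul]
    ring
  simp only [h, stressForm, stress, Finset.sum_mul]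
  symm
  rw [Finset.sum_comm]
  exact Finset.sum_congr rfl fun i _ => Finset.sum_comm

lemma trace_transpose_mul_self_nonneg (A : Matrix (Fin r) (Fin r) ℝ) :
    0 ≤ (A.transpose * A).trace := by
  rw [trace_transpose_mul]
  exact Finset.sum_nonneg fun α _ => Finset.sum_nonneg fun β _ => mul_self_nonneg _

lemma eq_zero_of_trace_transpose_mul_self {A : Matrix (Fin r) (Fin r) ℝ}
    (h : (A.transpose * A).trace = 0) : A = 0 := by
  rwa [← Matrix.conjTranspose_eq_transpose_of_trivial,
    Matrix.trace_conjTranspose_mul_self_eq_zero_iff] at h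

lemma stressForm_self_nonneg (x u : EuclideanSpace ℝ (Fin n)) : 0 ≤ D.stressForm x u u := by
  rw [stressForm_eq_sum_trace]
  exact Finset.sum_nonneg fun _ _ => trace_transpose_mul_self_nonneg _

lemma contractCurvature_eq_zero {x u : EuclideanSpace ℝ (Fin n)} (h : D.stressForm x u u = 0)
    (k : Fin n) : D.contractCurvature u k x = 0 := by
  rw [stressForm_eq_sum_trace,
    Finset.sum_eq_zero_iff_of_nonneg fun _ _ => trace_transpose_mul_self_nonneg _] at h
  exact eq_zero_of_trace_transpose_mul_self (h k (Finset.mem_univ k))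

lemma stressForm_left_eq_zero {x v : EuclideanSpace ℝ (Fin n)} (h : D.stressForm x v v = 0)
    (u : EuclideanSpace ℝ (Fin n)) : D.stressForm x u v = 0 := by
  rw [stressForm_eq_sum_trace]
  exact Finset.sum_eq_zero fun k _ => by rw [D.contractCurvature_eq_zero h k]; simp

lemma stress_self_nonneg (i : Fin n) (x : EuclideanSpace ℝ (Fin n)) : 0 ≤ D.stress i i x :=
  Finset.sum_nonneg fun _ _ => trace_transpose_mul_self_nonneg _

lemma curvatureNormSq_nonneg (x : EuclideanSpace ℝ (Fin n)) : 0 ≤ D.curvatureNormSq x :=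
  Finset.sum_nonneg fun i _ => D.stress_self_nonneg i x

/-- Entrywise `|ab| ≤ (a² + b²) / 2`. Through this bound every integrand below is dominated by a
multiple of `|F|²`. -/
lemma abs_stress_le (i j : Fin n) (x : EuclideanSpace ℝ (Fin n)) :
    |D.stress i j x| ≤ D.curvatureNormSq x := by
  have hle : ∀ i, D.stress i i x ≤ D.curvatureNormSq x := fun i =>
    Finset.single_le_sum (f := fun i => D.stress i i x) (fun i _ => D.stress_self_nonneg i x)
      (Finset.mem_univ i)
  have h : |D.stress i j x| ≤ (D.stress i i x + D.stress j j x) / 2 := by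
    have he : (D.stress i i x + D.stress j j x) / 2 = ∑ k, ∑ α, ∑ β,
        (D.curvature i k x α β ^ 2 + D.curvature j k x α β ^ 2) / 2 := by
      simp only [stress, trace_transpose_mul, ← Finset.sum_div, Finset.sum_add_distrib, pow_two]
    rw [he]
    simp only [stress, trace_transpose_mul]
    refine (Finset.abs_sum_le_sum_abs _ _).trans (Finset.sum_le_sum fun k _ => ?_)
    refine (Finset.abs_sum_le_sum_abs _ _).trans (Finset.sum_le_sum fun α _ => ?_)
    refine (Finset.abs_sum_le_sum_abs _ _).trans (Finset.sum_le_sum fun β _ => ?_)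
    rw [abs_le]
    constructor <;> nlinarith [sq_nonneg (D.curvature i k x α β + D.curvature j k x α β),
      sq_nonneg (D.curvature i k x α β - D.curvature j k x α β)]
  linarith [hle i, hle j]

end MetricConnection
end YangMills

/-! ### Gaussian integrability and the first variation formula. -/

namespace YangMills

open MeasureTheory Filter Topology

/-- A polynomial factor costs half of the Gaussian rate: `(1 + ρ)^k ≤ k! e^(1 + ρ)`, and `e^ρ` is
absorbed by completing the square. -/
lemma one_add_pow_mul_exp_le {c : ℝ} (hc : 0 < c) (k : ℕ) {ρ : ℝ} (hρ : 0 ≤ ρ) :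
    (1 + ρ) ^ k * Real.exp (-c * ρ ^ 2)
      ≤ k.factorial * Real.exp (1 + 1 / (2 * c)) * Real.exp (-(c / 2) * ρ ^ 2) := by
  have h1 : (1 + ρ) ^ k ≤ k.factorial * Real.exp (1 + ρ) := by
    have := Real.pow_div_factorial_le_exp (1 + ρ) (by linarith) k
    rwa [div_le_iff₀ (by positivity), mul_comm] at this
  have h2 : Real.exp (1 + ρ) * Real.exp (-c * ρ ^ 2)
      ≤ Real.exp (1 + 1 / (2 * c)) * Real.exp (-(c / 2) * ρ ^ 2) := by
    rw [← Real.exp_add, ← Real.exp_add, Real.exp_le_exp]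
    have h : 1 / (2 * c) + c / 2 * ρ ^ 2 - ρ = (c * ρ - 1) ^ 2 / (2 * c) := by
      field_simp
      ring
    have : 0 ≤ (c * ρ - 1) ^ 2 / (2 * c) := by positivity
    linarith
  calc (1 + ρ) ^ k * Real.exp (-c * ρ ^ 2)
      ≤ k.factorial * Real.exp (1 + ρ) * Real.exp (-c * ρ ^ 2) := by gcongr
    _ ≤ _ := by rw [mul_assoc, mul_assoc]; gcongr

lemma summable_eval_mul_exp (p : Polynomial ℝ) {c : ℝ} (hc : 0 < c) :
    Summable fun k : ℕ => p.eval ((k : ℝ) + 1) * Real.exp (-c * (k : ℝ) ^ 2) := by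
  have h : ∀ i : ℕ, Summable fun k : ℕ =>
      (p.comp (Polynomial.X + 1)).coeff i * ((k : ℝ) ^ i * Real.exp (-c * (k : ℝ) ^ 2)) := by
    refine fun i => Summable.mul_left _ (Summable.of_nonneg_of_le (fun k => by positivity)
      (fun k => ?_) (Real.summable_pow_mul_exp_neg_nat_mul i hc))
    have hk : (k : ℝ) ≤ (k : ℝ) ^ 2 := by exact_mod_cast Nat.le_self_pow two_ne_zero k
    gcongr ?_ * Real.exp ?_
    nlinarith
  refine (summable_sum (s := Finset.range ((p.comp (Polynomial.X + 1)).natDegree + 1))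
    fun i _ => h i).congr fun k => ?_
  have he : p.eval ((k : ℝ) + 1) = (p.comp (Polynomial.X + 1)).eval (k : ℝ) := by simp
  rw [he, Polynomial.eval_eq_sum_range, Finset.sum_mul]
  exact Finset.sum_congr rfl fun i _ => by ring

section Cutoff

variable {E : Type*} [NormedAddCommGroup E] [NormedSpace ℝ E] [FiniteDimensional ℝ E]

/-- Smooth cutoff functions exhausting the space, with bounded gradients tending to zero. -/
lemma exists_cutoff_sequence : ∃ (η : ℕ → E → ℝ) (C : ℝ), 0 ≤ C ∧
    (∀ m, ContDiff ℝ 1 (η m)) ∧ (∀ m, HasCompactSupport (η m)) ∧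
    (∀ m x, |η m x| ≤ 1) ∧ (∀ m x, ‖fderiv ℝ (η m) x‖ ≤ C) ∧
    (∀ x, Tendsto (fun m => η m x) atTop (𝓝 1)) ∧
    (∀ x, Tendsto (fun m => ‖fderiv ℝ (η m) x‖) atTop (𝓝 0)) := by
  let b : ContDiffBump (0 : E) := ⟨1, 2, one_pos, one_lt_two⟩
  have hb : ContDiff ℝ 1 (b : E → ℝ) := b.contDiff
  obtain ⟨C, hC⟩ := (hb.continuous_fderiv one_ne_zero).bounded_above_of_compact_support
    (b.hasCompactSupport.fderiv ℝ)
  have hC0 : 0 ≤ C := (norm_nonneg _).trans (hC 0)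
  have hpos : ∀ m : ℕ, (0 : ℝ) < (m : ℝ) + 1 := fun m => by positivity
  have hfd : ∀ (m : ℕ) (x : E), ‖fderiv ℝ (fun x => b (((m : ℝ) + 1)⁻¹ • x)) x‖
      ≤ C * ((m : ℝ) + 1)⁻¹ := fun m x => by
    have h1 : HasFDerivAt (fun x : E => ((m : ℝ) + 1)⁻¹ • x)
        (((m : ℝ) + 1)⁻¹ • ContinuousLinearMap.id ℝ E) x :=
      (hasFDerivAt_id x).const_smul _
    have h2 := ((hb.differentiable one_ne_zero) (((m : ℝ) + 1)⁻¹ • x)).hasFDerivAt.comp x h1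
    have h3 : fderiv ℝ (fun x => b (((m : ℝ) + 1)⁻¹ • x)) x
        = ((m : ℝ) + 1)⁻¹ • fderiv ℝ b (((m : ℝ) + 1)⁻¹ • x) := by
      rw [show (fun x => b (((m : ℝ) + 1)⁻¹ • x)) = b ∘ fun x : E => ((m : ℝ) + 1)⁻¹ • x from rfl,
        h2.fderiv]
      ext v
      simp
    rw [h3, norm_smul, Real.norm_of_nonneg (inv_nonneg.2 (hpos m).le), mul_comm]
    exact mul_le_mul_of_nonneg_right (hC _) (inv_nonneg.2 (hpos m).le)
  have hinv : Tendsto (fun m : ℕ => ((m : ℝ) + 1)⁻¹) atTop (𝓝 0) := by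
    simpa using tendsto_one_div_add_atTop_nhds_zero_nat (𝕜 := ℝ)
  refine ⟨fun m x => b (((m : ℝ) + 1)⁻¹ • x), C, hC0, fun m => hb.comp (contDiff_const_smul _),
    fun m => b.hasCompactSupport.comp_smul (inv_ne_zero (hpos m).ne'), fun m x => ?_,
    fun m x => (hfd m x).trans ?_, fun x => ?_, fun x => ?_⟩
  · rw [abs_of_nonneg b.nonneg]
    exact b.le_one
  · exact mul_le_of_le_one_right hC0 (inv_le_one_of_one_le₀ (by simp))
  · have h : Tendsto (fun m : ℕ => b (((m : ℝ) + 1)⁻¹ • x)) atTop (𝓝 (b ((0 : ℝ) • x))) :=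
      (b.continuous.tendsto _).comp (hinv.smul_const x)
    rwa [zero_smul, b.one_of_mem_closedBall (by simp [b])] at h
  · refine squeeze_zero (fun m => norm_nonneg _) (fun m => hfd m x) ?_
    simpa using hinv.const_mul C

/-- The integrand is the derivative of the compactly supported product `u v` in the direction `e`.
-/
lemma integrable_and_integral_mul_fderiv_add [MeasurableSpace E] [BorelSpace E] (μ : Measure E)
    [μ.IsAddHaarMeasure] {u v : E → ℝ} (hu : ContDiff ℝ 1 u) (hv : ContDiff ℝ 1 v)
    (hs : HasCompactSupport v) (e : E) :
    Integrable (fun x => u x * fderiv ℝ v x e + fderiv ℝ u x e * v x) μ ∧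
      ∫ x, (u x * fderiv ℝ v x e + fderiv ℝ u x e * v x) ∂μ = 0 := by
  have h1 : Integrable (fun x => u x * fderiv ℝ v x e) μ :=
    (hu.continuous.mul ((hv.continuous_fderiv one_ne_zero).clm_apply
      continuous_const)).integrable_of_hasCompactSupport (hs.fderiv_apply ℝ e).mul_left
  have h2 : Integrable (fun x => fderiv ℝ u x e * v x) μ :=
    (((hu.continuous_fderiv one_ne_zero).clm_apply continuous_const).mul
      hv.continuous).integrable_of_hasCompactSupport hs.mul_left
  have h3 : Integrable (fun x => u x * v x) μ :=
    (hu.continuous.mul hv.continuous).integrable_of_hasCompactSupport hs.mul_left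
  refine ⟨h1.add h2, ?_⟩
  rw [integral_add h1 h2, integral_mul_fderiv_eq_neg_fderiv_mul_of_integrable h2 h1 h3
    (fun x _ => hu.differentiable one_ne_zero x) (fun x _ => hv.differentiable one_ne_zero x)]
  ring

end Cutoff

namespace MetricConnection

variable {n r : ℕ} (D : MetricConnection n r)

local notation "𝔼" => EuclideanSpace ℝ (Fin n)

variable {D} in
lemma HasPolynomialEnergyGrowthAbout.integrable_mul_exp {y : 𝔼}
    (h : D.HasPolynomialEnergyGrowthAbout y) {c : ℝ} (hc : 0 < c) :
    Integrable fun x => D.curvatureNormSq x * Real.exp (-c * ‖x - y‖ ^ 2) := by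
  obtain ⟨p, hp⟩ := h
  have hcont : Continuous D.curvatureNormSq := D.contDiff_curvatureNormSq.continuous
  refine ⟨(hcont.mul (by fun_prop)).aestronglyMeasurable, ?_⟩
  have hball : ∀ k : ℕ, ∫⁻ x in Metric.ball y ((k : ℝ) + 1), ENNReal.ofReal (D.curvatureNormSq x)
      ≤ ENNReal.ofReal (p.eval ((k : ℝ) + 1)) := fun k => by
    rw [← ofReal_integral_eq_lintegral_ofReal]
    · exact ENNReal.ofReal_le_ofReal (hp _ (by positivity))
    · exact (hcont.continuousOn.integrableOn_compact
        (isCompact_closedBall y ((k : ℝ) + 1))).mono_set Metric.ball_subset_closedBall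
    · exact ae_of_all _ D.curvatureNormSq_nonneg
  -- The term with `k = ⌊‖x - y‖⌋` alone dominates. Full balls instead of annuli overcount, but the
  -- series still converges since the Gaussian beats `p`.
  have hpt : ∀ x, ‖D.curvatureNormSq x * Real.exp (-c * ‖x - y‖ ^ 2)‖ₑ
      ≤ ∑' k : ℕ, ENNReal.ofReal (Real.exp (-c * (k : ℝ) ^ 2)) *
        (Metric.ball y ((k : ℝ) + 1)).indicator (fun x => ENNReal.ofReal (D.curvatureNormSq x)) x := by
    intro x
    refine le_trans ?_ (ENNReal.le_tsum ⌊‖x - y‖⌋₊)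
    have hx : x ∈ Metric.ball y ((⌊‖x - y‖⌋₊ : ℝ) + 1) := by
      rw [Metric.mem_ball, dist_eq_norm]
      exact Nat.lt_floor_add_one _
    rw [Set.indicator_of_mem hx, Real.enorm_of_nonneg
      (mul_nonneg (D.curvatureNormSq_nonneg x) (Real.exp_nonneg _)), mul_comm,
      ENNReal.ofReal_mul (Real.exp_nonneg _)]
    have := Nat.floor_le (norm_nonneg (x - y))
    refine mul_le_mul_left (ENNReal.ofReal_le_ofReal (Real.exp_le_exp.2 ?_)) _
    rw [neg_mul, neg_mul, neg_le_neg_iff]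
    gcongr
  refine (lintegral_mono hpt).trans_lt ?_
  rw [lintegral_tsum fun k => ((hcont.measurable.ennreal_ofReal.indicator
    measurableSet_ball).const_mul _).aemeasurable]
  refine lt_of_le_of_lt (ENNReal.tsum_le_tsum (g := fun k : ℕ =>
    ENNReal.ofReal (p.eval ((k : ℝ) + 1) * Real.exp (-c * (k : ℝ) ^ 2))) fun k => ?_) ?_
  · rw [lintegral_const_mul _ (hcont.measurable.ennreal_ofReal.indicator measurableSet_ball),
      lintegral_indicator measurableSet_ball, mul_comm, ENNReal.ofReal_mul' (Real.exp_nonneg _)]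
    gcongr
    exact hball k
  · exact (summable_eval_mul_exp p hc).tsum_ofReal_lt_top

variable {D} in
-- Recentring at the origin: `‖x - y‖² ≤ 2‖x‖² + 2‖y‖²`, so the Gaussian about `y` of rate `c / 2`
-- dominates up to a constant.
lemma HasPolynomialEnergyGrowth.integrable_mul_exp (h : D.HasPolynomialEnergyGrowth) {c : ℝ}
    (hc : 0 < c) : Integrable fun x => D.curvatureNormSq x * Real.exp (-c * ‖x‖ ^ 2) := by
  obtain ⟨y, hy⟩ := h
  have hcont : Continuous D.curvatureNormSq := D.contDiff_curvatureNormSq.continuous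
  refine ((hy.integrable_mul_exp (half_pos hc)).const_mul (Real.exp (c * ‖y‖ ^ 2))).mono'
    (hcont.mul (by fun_prop)).aestronglyMeasurable (ae_of_all _ fun x => ?_)
  rw [Real.norm_of_nonneg (mul_nonneg (D.curvatureNormSq_nonneg x) (Real.exp_nonneg _)),
    mul_left_comm, ← Real.exp_add]
  refine mul_le_mul_of_nonneg_left (Real.exp_le_exp.2 ?_) (D.curvatureNormSq_nonneg x)
  have h1 : ‖x - y‖ ^ 2 ≤ 2 * ‖x‖ ^ 2 + 2 * ‖y‖ ^ 2 := by
    nlinarith [norm_sub_le x y, norm_nonneg (x - y), sq_nonneg (‖x‖ - ‖y‖)]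
  nlinarith

variable {D} in
lemma HasPolynomialEnergyGrowth.integrable_mul_pow_mul_exp (h : D.HasPolynomialEnergyGrowth)
    {c : ℝ} (hc : 0 < c) (k : ℕ) :
    Integrable fun x => D.curvatureNormSq x * ((1 + ‖x‖) ^ k * Real.exp (-c * ‖x‖ ^ 2)) := by
  have hcont : Continuous D.curvatureNormSq := D.contDiff_curvatureNormSq.continuous
  refine ((h.integrable_mul_exp (half_pos hc)).const_mul
    (k.factorial * Real.exp (1 + 1 / (2 * c)))).mono'
    (hcont.mul (by fun_prop)).aestronglyMeasurable (ae_of_all _ fun x => ?_)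
  rw [Real.norm_of_nonneg (mul_nonneg (D.curvatureNormSq_nonneg x) (by positivity)),
    mul_left_comm (_ * _)]
  exact mul_le_mul_of_nonneg_left (one_add_pow_mul_exp_le hc k (norm_nonneg x))
    (D.curvatureNormSq_nonneg x)

lemma continuous_stressForm {u v : 𝔼 → 𝔼} (hu : Continuous u) (hv : Continuous v) :
    Continuous fun x => D.stressForm x (u x) (v x) := by
  have := fun i j => (D.contDiff_stress i j).continuous
  unfold stressForm
  fun_prop

lemma abs_stressForm_le (x u v : 𝔼) :
    |D.stressForm x u v| ≤ n ^ 2 * (D.curvatureNormSq x * (‖u‖ * ‖v‖)) := by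
  have h : ∀ i j, |D.stress i j x * u i * v j| ≤ D.curvatureNormSq x * (‖u‖ * ‖v‖) := fun i j => by
    rw [abs_mul, abs_mul, mul_assoc]
    have h1 : |u i| ≤ ‖u‖ := PiLp.norm_apply_le u i
    have h2 : |v j| ≤ ‖v‖ := PiLp.norm_apply_le v j
    have h3 := D.abs_stress_le i j x
    have h4 := D.curvatureNormSq_nonneg x
    gcongr
  calc |D.stressForm x u v| ≤ ∑ _i : Fin n, ∑ _j : Fin n, D.curvatureNormSq x * (‖u‖ * ‖v‖) :=
        (Finset.abs_sum_le_sum_abs _ _).trans (Finset.sum_le_sum fun i _ =>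
          (Finset.abs_sum_le_sum_abs _ _).trans (Finset.sum_le_sum fun j _ => h i j))
    _ = _ := by simp; ring

/-- The pairing of the stress-energy tensor `S - |F|² / 4` with the endomorphism `A`. -/
def stressPairing (x : 𝔼) (A : 𝔼 →L[ℝ] 𝔼) : ℝ :=
  ∑ i, ∑ j, D.stress i j x * A (EuclideanSpace.single i 1) j
    - 1 / 4 * D.curvatureNormSq x * ∑ i, A (EuclideanSpace.single i 1) i

lemma stressPairing_add (x : 𝔼) (A B : 𝔼 →L[ℝ] 𝔼) :
    D.stressPairing x (A + B) = D.stressPairing x A + D.stressPairing x B := by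
  simp only [stressPairing, add_apply, PiLp.add_apply, mul_add, Finset.sum_add_distrib]
  ring

lemma stressPairing_smul (c : ℝ) (x : 𝔼) (A : 𝔼 →L[ℝ] 𝔼) :
    D.stressPairing x (c • A) = c * D.stressPairing x A := by
  simp only [stressPairing, smul_apply, PiLp.smul_apply, smul_eq_mul, mul_left_comm _ c,
    ← Finset.mul_sum, mul_sub]

lemma stressPairing_id (x : 𝔼) :
    D.stressPairing x (ContinuousLinearMap.id ℝ 𝔼) = (4 - n) / 4 * D.curvatureNormSq x := by
  simp [stressPairing, curvatureNormSq_eq_sum_stress]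
  ring

/-- Rank-one endomorphisms of this kind arise when the derivative of a heat kernel times a field
falls on the kernel. -/
lemma stressPairing_smulRight_inner (x z u : 𝔼) :
    D.stressPairing x ((innerSL ℝ z).smulRight u)
      = D.stressForm x z u - 1 / 4 * D.curvatureNormSq x * inner ℝ z u := by
  simp [stressPairing, stressForm, PiLp.inner_apply, mul_assoc, mul_comm]

lemma continuous_stressPairing {A : 𝔼 → 𝔼 →L[ℝ] 𝔼} (hA : Continuous A) :
    Continuous fun x => D.stressPairing x (A x) := by
  have := fun i j => (D.contDiff_stress i j).continuous
  have := D.contDiff_curvatureNormSq.continuous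
  unfold stressPairing
  fun_prop

lemma abs_stressPairing_le (x : 𝔼) (A : 𝔼 →L[ℝ] 𝔼) :
    |D.stressPairing x A| ≤ (n ^ 2 + n) * (D.curvatureNormSq x * ‖A‖) := by
  have h4 := D.curvatureNormSq_nonneg x
  have hA : ∀ i j, |A (EuclideanSpace.single i 1) j| ≤ ‖A‖ := fun i j =>
    (PiLp.norm_apply_le (A (EuclideanSpace.single i 1)) j).trans
      ((A.le_opNorm _).trans (by simp))
  have h1 : |∑ i, ∑ j, D.stress i j x * A (EuclideanSpace.single i 1) j|
      ≤ n ^ 2 * (D.curvatureNormSq x * ‖A‖) := by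
    calc _ ≤ ∑ _i : Fin n, ∑ _j : Fin n, D.curvatureNormSq x * ‖A‖ :=
          (Finset.abs_sum_le_sum_abs _ _).trans (Finset.sum_le_sum fun i _ =>
            (Finset.abs_sum_le_sum_abs _ _).trans (Finset.sum_le_sum fun j _ => by
              rw [abs_mul]
              exact mul_le_mul (D.abs_stress_le i j x) (hA i j) (abs_nonneg _) h4))
      _ = _ := by simp; ring
  have h2 : |∑ i, A (EuclideanSpace.single i 1) i| ≤ n * ‖A‖ := by
    calc _ ≤ ∑ _i : Fin n, ‖A‖ :=
          (Finset.abs_sum_le_sum_abs _ _).trans (Finset.sum_le_sum fun i _ => hA i i)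
      _ = _ := by simp
  have h3 : |1 / 4 * D.curvatureNormSq x * ∑ i, A (EuclideanSpace.single i 1) i|
      ≤ n * (D.curvatureNormSq x * ‖A‖) := by
    rw [abs_mul, abs_of_nonneg (by positivity)]
    calc _ ≤ 1 * D.curvatureNormSq x * (n * ‖A‖) := by gcongr; norm_num
      _ = _ := by ring
  calc |D.stressPairing x A| ≤ _ := abs_sub _ _
    _ ≤ _ := add_le_add h1 h3
    _ = _ := by ring

variable {D} in
/-- The first variation formula for a soliton, for compactly supported vector fields. -/
lemma IsSoliton.integral_stressPairing_of_hasCompactSupport (hD : D.IsSoliton) {φ : 𝔼 → 𝔼}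
    (hφ : ContDiff ℝ 1 φ) (hs : HasCompactSupport φ) :
    ∫ x, (1 / 2 * D.stressForm x x (φ x) + D.stressPairing x (fderiv ℝ φ x)) = 0 := by
  have hcd : ∀ j, ContDiff ℝ 1 fun x => φ x j := fun j =>
    (EuclideanSpace.proj (𝕜 := ℝ) j).contDiff.comp hφ
  have hcs : ∀ j, HasCompactSupport fun x => φ x j := fun j =>
    hs.comp_left (g := fun v : 𝔼 => v j) rfl
  have hfd : ∀ j x e, fderiv ℝ (fun x => φ x j) x e = (fderiv ℝ φ x e) j := fun j x e => by
    have := ((EuclideanSpace.proj (𝕜 := ℝ) j).hasFDerivAt.comp x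
      (hφ.differentiable one_ne_zero x).hasFDerivAt).fderiv
    exact congrArg (fun L : 𝔼 →L[ℝ] ℝ => L e) this
  have h1 := fun i j => integrable_and_integral_mul_fderiv_add volume
    ((D.contDiff_stress i j).of_le (m := 1) (by norm_cast)) (hcd j) (hcs j)
    (EuclideanSpace.single i 1)
  have h2 := fun j => integrable_and_integral_mul_fderiv_add volume
    (D.contDiff_curvatureNormSq.of_le (m := 1) (by norm_cast)) (hcd j) (hcs j)
    (EuclideanSpace.single j 1)
  -- By the divergence identity the integrand is that of `div (S φ) - ¼ div (|F|² φ)`, a sum of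
  -- product-rule pieces each integrating to zero.
  have hpt : ∀ x, 1 / 2 * D.stressForm x x (φ x) + D.stressPairing x (fderiv ℝ φ x)
      = (∑ i, ∑ j, (D.stress i j x * fderiv ℝ (fun x => φ x j) x (EuclideanSpace.single i 1)
          + fderiv ℝ (D.stress i j) x (EuclideanSpace.single i 1) * φ x j))
        - 1 / 4 * ∑ j, (D.curvatureNormSq x
          * fderiv ℝ (fun x => φ x j) x (EuclideanSpace.single j 1)
          + fderiv ℝ D.curvatureNormSq x (EuclideanSpace.single j 1) * φ x j) := by
    intro x
    have h3 : ∑ i, ∑ j, fderiv ℝ (D.stress i j) x (EuclideanSpace.single i 1) * φ x j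
        = 1 / 4 * ∑ j, fderiv ℝ D.curvatureNormSq x (EuclideanSpace.single j 1) * φ x j
          + 1 / 2 * D.stressForm x x (φ x) := by
      have hS : D.stressForm x x (φ x) = ∑ j, ∑ i, D.stress i j x * x i * φ x j := Finset.sum_comm
      rw [Finset.sum_comm, hS, Finset.mul_sum, Finset.mul_sum, ← Finset.sum_add_distrib]
      refine Finset.sum_congr rfl fun j _ => ?_
      rw [← Finset.sum_mul, hD.sum_fderiv_stress, add_mul, mul_assoc, mul_assoc, Finset.sum_mul]
      simp only [mul_comm (x _)]
    simp only [Finset.sum_add_distrib, h3, hfd, stressPairing, ← Finset.mul_sum]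
    ring
  simp only [hpt]
  rw [integral_sub, integral_const_mul, integral_finsetSum _ fun j _ => (h2 j).1,
    integral_finsetSum]
  · simp only [(h2 _).2]
    rw [Finset.sum_eq_zero]
    · simp
    · intro i _
      rw [integral_finsetSum _ fun j _ => (h1 i j).1]
      exact Finset.sum_eq_zero fun j _ => (h1 i j).2
  · exact fun i _ => integrable_finsetSum _ fun j _ => (h1 i j).1
  · exact integrable_finsetSum _ fun i _ => integrable_finsetSum _ fun j _ => (h1 i j).1
  · exact (integrable_finsetSum _ fun j _ => (h2 j).1).const_mul _

variable {D} in
/-- The first variation formula for a soliton, for decaying vector fields. -/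
theorem IsSoliton.integral_stressPairing (hD : D.IsSoliton) {φ : 𝔼 → 𝔼} (hφ : ContDiff ℝ 1 φ)
    {B : 𝔼 → ℝ} (hB : Integrable fun x => D.curvatureNormSq x * B x)
    (h1 : ∀ x, (1 + ‖x‖) * ‖φ x‖ ≤ B x) (h2 : ∀ x, ‖fderiv ℝ φ x‖ ≤ B x) :
    ∫ x, (1 / 2 * D.stressForm x x (φ x) + D.stressPairing x (fderiv ℝ φ x)) = 0 := by
  obtain ⟨η, C, hC, hη, hηs, hη1, hηC, hlim, hlim'⟩ := exists_cutoff_sequence (E := 𝔼)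
  have hfd : ∀ m x, fderiv ℝ (fun x => η m x • φ x) x
      = η m x • fderiv ℝ φ x + (fderiv ℝ (η m) x).smulRight (φ x) := fun m x =>
    fderiv_fun_smul ((hη m).differentiable one_ne_zero x) (hφ.differentiable one_ne_zero x)
  have hsm : ∀ m, ContDiff ℝ 1 fun x => η m x • φ x := fun m => (hη m).smul hφ
  -- The hypothesis `h1` serves twice: `‖φ‖ ≤ B` controls the error from the gradient of the cutoff,
  -- and `‖x‖ ‖φ‖ ≤ B` the term `S(x, φ)`.
  have hb1 : ∀ x, ‖φ x‖ ≤ B x := fun x =>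
    le_trans (le_mul_of_one_le_left (norm_nonneg _) (by simp)) (h1 x)
  have hb2 : ∀ x, ‖x‖ * ‖φ x‖ ≤ B x := fun x =>
    le_trans (mul_le_mul_of_nonneg_right (by simp) (norm_nonneg _)) (h1 x)
  have hf := D.curvatureNormSq_nonneg
  have hform : ∀ x, |D.stressForm x x (φ x)| ≤ n ^ 2 * (D.curvatureNormSq x * B x) := fun x =>
    (D.abs_stressForm_le x x (φ x)).trans (by gcongr; exacts [hf x, hb2 x])
  have hpair : ∀ x, |D.stressPairing x (fderiv ℝ φ x)|
      ≤ (n ^ 2 + n) * (D.curvatureNormSq x * B x) := fun x =>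
    (D.abs_stressPairing_le x _).trans (by gcongr; exacts [hf x, h2 x])
  have herr : ∀ m x, |D.stressPairing x ((fderiv ℝ (η m) x).smulRight (φ x))|
      ≤ (n ^ 2 + n) * (D.curvatureNormSq x * B x) * ‖fderiv ℝ (η m) x‖ := fun m x => by
    refine (D.abs_stressPairing_le x _).trans ?_
    rw [ContinuousLinearMap.norm_smulRight_apply, mul_assoc (_ + _), mul_assoc _ (B x),
      mul_comm (B x)]
    gcongr
    exacts [hf x, hb1 x]
  have hsplit : ∀ m x, 1 / 2 * D.stressForm x x (η m x • φ x)
      + D.stressPairing x (fderiv ℝ (fun x => η m x • φ x) x)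
      = η m x * (1 / 2 * D.stressForm x x (φ x) + D.stressPairing x (fderiv ℝ φ x))
        + D.stressPairing x ((fderiv ℝ (η m) x).smulRight (φ x)) := fun m x => by
    rw [hfd, stressForm_smul_right, stressPairing_add, stressPairing_smul]
    ring
  have hconv := tendsto_integral_of_dominated_convergence (μ := volume)
    (F := fun m x => 1 / 2 * D.stressForm x x (η m x • φ x)
      + D.stressPairing x (fderiv ℝ (fun x => η m x • φ x) x))
    (f := fun x => 1 / 2 * D.stressForm x x (φ x) + D.stressPairing x (fderiv ℝ φ x))
    (fun x => (1 / 2 * n ^ 2 + (n ^ 2 + n) + (n ^ 2 + n) * C) * (D.curvatureNormSq x * B x))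
    (fun m => ((continuous_const.mul (D.continuous_stressForm continuous_id (hsm m).continuous)).add
      (D.continuous_stressPairing ((hsm m).continuous_fderiv one_ne_zero))).aestronglyMeasurable)
    (hB.const_mul _) ?_ ?_
  · have h0 : ∀ m, ∫ x, (1 / 2 * D.stressForm x x (η m x • φ x)
        + D.stressPairing x (fderiv ℝ (fun x => η m x • φ x) x)) = 0 := fun m =>
      hD.integral_stressPairing_of_hasCompactSupport (hsm m) (hηs m).smul_right
    simp only [h0] at hconv
    exact (tendsto_nhds_unique hconv tendsto_const_nhds)
  · refine fun m => ae_of_all _ fun x => ?_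
    have hB0 : 0 ≤ D.curvatureNormSq x * B x := mul_nonneg (hf x) ((norm_nonneg _).trans (h2 x))
    rw [hsplit, Real.norm_eq_abs]
    refine (abs_add_le _ _).trans ?_
    rw [abs_mul]
    have e1 : |1 / 2 * D.stressForm x x (φ x) + D.stressPairing x (fderiv ℝ φ x)|
        ≤ (1 / 2 * n ^ 2 + (n ^ 2 + n)) * (D.curvatureNormSq x * B x) := by
      refine (abs_add_le _ _).trans ?_
      rw [abs_mul, abs_of_pos (by norm_num : (0 : ℝ) < 1 / 2)]
      linarith [hform x, hpair x]
    have e2 := mul_le_mul (hη1 m x) e1 (abs_nonneg _) zero_le_one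
    have e3 : (n ^ 2 + n) * (D.curvatureNormSq x * B x) * ‖fderiv ℝ (η m) x‖
        ≤ (n ^ 2 + n) * (D.curvatureNormSq x * B x) * C := by
      gcongr
      exact hηC m x
    linarith [herr m x]
  · refine ae_of_all _ fun x => ?_
    simp only [hsplit]
    have e1 := (hlim x).mul_const
      (1 / 2 * D.stressForm x x (φ x) + D.stressPairing x (fderiv ℝ φ x))
    have e2 : Tendsto (fun m => D.stressPairing x ((fderiv ℝ (η m) x).smulRight (φ x)))
        atTop (𝓝 0) := by
      refine squeeze_zero_norm (herr · x) ?_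
      simpa using (hlim' x).const_mul ((n ^ 2 + n) * (D.curvatureNormSq x * B x))
    simpa using e1.add e2

end MetricConnection
end YangMills

/-! ### The heat kernel and the functional along parabolic paths. -/

namespace YangMills

open MeasureTheory Filter Topology

variable {n r : ℕ}

local notation "𝔼" => EuclideanSpace ℝ (Fin n)

/-- The backward heat kernel `(4πt)^{-n/2} exp(-|x - x₀|² / (4t))`. -/
def heatKernel (x₀ : 𝔼) (t : ℝ) (x : 𝔼) : ℝ :=
  (4 * Real.pi * t) ^ (-(n : ℝ) / 2) * Real.exp (-‖x - x₀‖ ^ 2 / (4 * t))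

lemma heatKernel_pos (x₀ : 𝔼) {t : ℝ} (ht : 0 < t) (x : 𝔼) : 0 < heatKernel x₀ t x := by
  have := Real.pi_pos
  unfold heatKernel
  positivity

lemma contDiff_heatKernel (x₀ : 𝔼) (t : ℝ) : ContDiff ℝ ∞ (heatKernel x₀ t) := by
  have h : ContDiff ℝ ∞ fun x : 𝔼 => ‖x - x₀‖ ^ 2 := (contDiff_id.sub contDiff_const).norm_sq ℝ
  exact contDiff_const.mul ((h.neg.div_const _).exp)

lemma hasFDerivAt_heatKernel (x₀ : 𝔼) (t : ℝ) (x : 𝔼) :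
    HasFDerivAt (heatKernel x₀ t) ((-(heatKernel x₀ t x / (2 * t))) • innerSL ℝ (x - x₀)) x := by
  have h1 : HasFDerivAt (fun x : 𝔼 => x - x₀) (ContinuousLinearMap.id ℝ 𝔼) x :=
    (hasFDerivAt_id x).sub_const x₀
  have h2 : HasFDerivAt (fun x : 𝔼 => (-(4 * t)⁻¹) * ‖x - x₀‖ ^ 2)
      ((-(4 * t)⁻¹) • (2 • (innerSL ℝ (x - x₀)).comp (ContinuousLinearMap.id ℝ 𝔼))) x :=
    h1.norm_sq.const_mul _
  have h3 := (h2.exp).const_mul ((4 * Real.pi * t) ^ (-(n : ℝ) / 2))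
  have he : heatKernel x₀ t = fun x : 𝔼 => (4 * Real.pi * t) ^ (-(n : ℝ) / 2)
      * Real.exp ((-(4 * t)⁻¹) * ‖x - x₀‖ ^ 2) := by
    funext x
    rw [heatKernel, show -‖x - x₀‖ ^ 2 / (4 * t) = -(4 * t)⁻¹ * ‖x - x₀‖ ^ 2 by ring]
  rw [he]
  refine h3.congr_fderiv ?_
  ext v
  simp only [smul_apply, ContinuousLinearMap.comp_id, smul_eq_mul, nsmul_eq_mul, mul_inv]
  push_cast
  ring

/-- One Gaussian about the origin dominates all kernels with `τ ≤ t ≤ T` and `‖x₀‖ ≤ R`, by `‖x -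
x₀‖² ≥ ‖x‖² / 2 - R²`. It is the majorant for continuity and for differentiation under the integral.
-/
lemma heatKernel_le {x₀ : 𝔼} {t τ T R : ℝ} (hτ : 0 < τ) (hτt : τ ≤ t) (htT : t ≤ T)
    (hR : ‖x₀‖ ≤ R) (x : 𝔼) :
    heatKernel x₀ t x ≤ (4 * Real.pi * τ) ^ (-(n : ℝ) / 2) * Real.exp (R ^ 2 / (4 * T))
      * Real.exp (-(1 / (8 * T)) * ‖x‖ ^ 2) := by
  have ht : 0 < t := hτ.trans_le hτt
  have hT : 0 < T := ht.trans_le htT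
  have hpi := Real.pi_pos
  rw [mul_assoc, ← Real.exp_add, heatKernel]
  have h1 : (4 * Real.pi * t) ^ (-(n : ℝ) / 2) ≤ (4 * Real.pi * τ) ^ (-(n : ℝ) / 2) :=
    Real.rpow_le_rpow_of_nonpos (by positivity) (by gcongr)
      (div_nonpos_of_nonpos_of_nonneg (by simp) (by norm_num))
  have h2 : ‖x‖ ^ 2 / 2 - R ^ 2 ≤ ‖x - x₀‖ ^ 2 := by
    have h3 : ‖x‖ ≤ ‖x - x₀‖ + ‖x₀‖ := by simpa using norm_add_le (x - x₀) x₀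
    nlinarith [norm_nonneg x, norm_nonneg x₀, sq_nonneg (‖x - x₀‖ - ‖x₀‖)]
  have h4 : -‖x - x₀‖ ^ 2 / (4 * t) ≤ R ^ 2 / (4 * T) + -(1 / (8 * T)) * ‖x‖ ^ 2 := by
    have h5 : ‖x - x₀‖ ^ 2 / (4 * T) ≤ ‖x - x₀‖ ^ 2 / (4 * t) := by gcongr
    have h6 : (‖x‖ ^ 2 / 2 - R ^ 2) / (4 * T) ≤ ‖x - x₀‖ ^ 2 / (4 * T) := by gcongr
    have h7 : R ^ 2 / (4 * T) + -(1 / (8 * T)) * ‖x‖ ^ 2 = -((‖x‖ ^ 2 / 2 - R ^ 2) / (4 * T)) := by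
      field_simp
      ring
    rw [h7, neg_div]
    linarith
  exact mul_le_mul h1 (Real.exp_le_exp.2 h4) (Real.exp_nonneg _) (by positivity)

lemma norm_sub_le_mul (x x₀ : 𝔼) : ‖x - x₀‖ ≤ (1 + ‖x₀‖) * (1 + ‖x‖) :=
  (norm_sub_le x x₀).trans (by nlinarith [norm_nonneg x, norm_nonneg x₀])

lemma norm_add_smul_sub_le (x₀ y : 𝔼) (c : ℝ) (x : 𝔼) :
    ‖y + c • (x - x₀)‖ ≤ (‖y‖ + |c| * (1 + ‖x₀‖)) * (1 + ‖x‖) := by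
  have h1 : ‖y + c • (x - x₀)‖ ≤ ‖y‖ + |c| * ‖x - x₀‖ := by
    simpa [norm_smul] using norm_add_le y (c • (x - x₀))
  have h2 := mul_le_mul_of_nonneg_left (norm_sub_le_mul x x₀) (abs_nonneg c)
  nlinarith [mul_nonneg (norm_nonneg y) (norm_nonneg x)]

/-- The derivative of the weight along the path `s ↦ (s y, 1 + a s²)`. -/
lemma hasDerivAt_heatKernel_path (y x : 𝔼) (a : ℝ) {s : ℝ} (ht : 0 < 1 + a * s ^ 2) :
    HasDerivAt (fun s => (1 + a * s ^ 2) ^ 2 * heatKernel (s • y) (1 + a * s ^ 2) x)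
      (heatKernel (s • y) (1 + a * s ^ 2) x *
        (2 * a * s * ((4 - n) / 2 * (1 + a * s ^ 2) + ‖x - s • y‖ ^ 2 / 4)
          + (1 + a * s ^ 2) / 2 * inner ℝ (x - s • y) y)) s := by
  have hpi := Real.pi_pos
  have h1 : HasDerivAt (fun s : ℝ => 1 + a * s ^ 2) (a * (2 * s)) s := by
    simpa using ((hasDerivAt_pow 2 s).const_mul a).const_add 1
  have h2 := (h1.const_mul (4 * Real.pi)).rpow_const (p := -(n : ℝ) / 2)
    (Or.inl (by positivity))
  have h3 : HasDerivAt (fun s : ℝ => x - s • y) (-y) s := by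
    simpa using ((hasDerivAt_id s).smul_const y).const_sub x
  have h4 := (h3.norm_sq.fun_neg.fun_div (h1.const_mul 4) (by positivity)).exp
  have h5 := (h1.fun_pow 2).fun_mul (h2.fun_mul h4)
  refine h5.congr_deriv ?_
  rw [Real.rpow_sub_one (by positivity), inner_neg_right, heatKernel]
  push_cast
  field_simp
  ring

namespace MetricConnection

variable (D : MetricConnection n r)

/-- The functional `F_{x₀,t₀}` as a real number. -/
def realFunctional (x₀ : 𝔼) (t : ℝ) : ℝ :=
  ∫ x, D.curvatureNormSq x * (t ^ 2 * heatKernel x₀ t x)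

variable {D}

lemma HasPolynomialEnergyGrowth.integrable_mul_heatKernel (h : D.HasPolynomialEnergyGrowth)
    (x₀ : 𝔼) {t : ℝ} (ht : 0 < t) (k : ℕ) :
    Integrable fun x => D.curvatureNormSq x * ((1 + ‖x‖) ^ k * heatKernel x₀ t x) := by
  have hcont : Continuous D.curvatureNormSq := D.contDiff_curvatureNormSq.continuous
  refine ((h.integrable_mul_pow_mul_exp (c := 1 / (8 * t)) (by positivity) k).const_mul
    ((4 * Real.pi * t) ^ (-(n : ℝ) / 2) * Real.exp (‖x₀‖ ^ 2 / (4 * t)))).mono'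
    (hcont.mul (.mul (by fun_prop)
      (contDiff_heatKernel x₀ t).continuous)).aestronglyMeasurable (ae_of_all _ fun x => ?_)
  have hf := D.curvatureNormSq_nonneg x
  have hw := (heatKernel_pos x₀ ht x).le
  rw [Real.norm_of_nonneg (by positivity), mul_left_comm (_ * _), mul_left_comm (_ * _)]
  gcongr
  exact heatKernel_le ht le_rfl le_rfl le_rfl x

/-- Integrability makes the functional finite, so the analysis can be done with real values. -/
lemma HasPolynomialEnergyGrowth.functional_eq (h : D.HasPolynomialEnergyGrowth) (x₀ : 𝔼) {t : ℝ}
    (ht : 0 < t) : D.functional x₀ t = ENNReal.ofReal (D.realFunctional x₀ t) := by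
  have hi : Integrable fun x => D.curvatureNormSq x * heatKernel x₀ t x := by
    simpa using h.integrable_mul_heatKernel x₀ ht 0
  have he : D.realFunctional x₀ t = t ^ 2 * ∫ x, D.curvatureNormSq x * heatKernel x₀ t x := by
    rw [realFunctional, ← integral_const_mul]
    exact integral_congr_ae (ae_of_all _ fun x => by ring)
  rw [he, ENNReal.ofReal_mul (by positivity), ofReal_integral_eq_lintegral_ofReal hi
    (ae_of_all _ fun x => mul_nonneg (D.curvatureNormSq_nonneg x) (heatKernel_pos x₀ ht x).le)]
  rfl

lemma realFunctional_nonneg (x₀ : 𝔼) {t : ℝ} (ht : 0 < t) : 0 ≤ D.realFunctional x₀ t :=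
  integral_nonneg fun x => mul_nonneg (D.curvatureNormSq_nonneg x)
    (mul_nonneg (sq_nonneg t) (heatKernel_pos x₀ ht x).le)

lemma HasPolynomialEnergyGrowth.continuousAt_realFunctional (h : D.HasPolynomialEnergyGrowth)
    (x₀ : 𝔼) {t₀ : ℝ} (ht₀ : 0 < t₀) :
    ContinuousAt (fun p : 𝔼 × ℝ => D.realFunctional p.1 p.2) (x₀, t₀) := by
  have hcont : Continuous D.curvatureNormSq := D.contDiff_curvatureNormSq.continuous
  have hnhds : ∀ᶠ p : 𝔼 × ℝ in 𝓝 (x₀, t₀), t₀ / 2 ≤ p.2 ∧ p.2 ≤ 2 * t₀ ∧ ‖p.1‖ ≤ ‖x₀‖ + 1 := by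
    have h1 : ∀ᶠ t in 𝓝 t₀, t₀ / 2 ≤ t := Ici_mem_nhds (by linarith)
    have h2 : ∀ᶠ t in 𝓝 t₀, t ≤ 2 * t₀ := Iic_mem_nhds (by linarith)
    have h3 : ∀ᶠ x in 𝓝 x₀, ‖x‖ ≤ ‖x₀‖ + 1 :=
      (continuous_norm.tendsto x₀).eventually (Iic_mem_nhds (by linarith))
    have e1 := (continuous_snd.tendsto (x₀, t₀)).eventually (h1.and h2)
    have e2 := (continuous_fst.tendsto (x₀, t₀)).eventually h3
    filter_upwards [e1, e2] with p hp hq using ⟨hp.1, hp.2, hq⟩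
  refine continuousAt_of_dominated (bound := fun x => (2 * t₀) ^ 2 *
    ((4 * Real.pi * (t₀ / 2)) ^ (-(n : ℝ) / 2) * Real.exp ((‖x₀‖ + 1) ^ 2 / (4 * (2 * t₀)))) *
      (D.curvatureNormSq x * Real.exp (-(1 / (8 * (2 * t₀))) * ‖x‖ ^ 2)))
    (Eventually.of_forall fun p => (hcont.mul (continuous_const.mul
      (contDiff_heatKernel p.1 p.2).continuous)).aestronglyMeasurable) ?_
    ((h.integrable_mul_exp (by positivity)).const_mul _) ?_
  · filter_upwards [hnhds] with p hp
    refine ae_of_all _ fun x => ?_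
    have hp2 : 0 < p.2 := (half_pos ht₀).trans_le hp.1
    have hf := D.curvatureNormSq_nonneg x
    have hw := heatKernel_pos p.1 hp2 x
    have hle := heatKernel_le (half_pos ht₀) hp.1 hp.2.1 hp.2.2 x
    rw [Real.norm_of_nonneg (by positivity), mul_left_comm (_ * _), mul_assoc ((2 * t₀) ^ 2)]
    have := hp.2.1
    gcongr
  · refine ae_of_all _ fun x => ContinuousAt.mul continuousAt_const (ContinuousAt.mul
      (by fun_prop) (ContinuousAt.mul ?_ ?_))
    · exact ContinuousAt.rpow_const (by fun_prop) (Or.inl (by positivity))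
    · exact (ContinuousAt.div (by fun_prop) (by fun_prop) (by positivity)).rexp

lemma HasPolynomialEnergyGrowth.integrable_heatKernel_mul_stressForm
    (hg : D.HasPolynomialEnergyGrowth) (x₀ y : 𝔼) {t : ℝ} (ht : 0 < t) (c : ℝ) :
    Integrable fun x =>
      heatKernel x₀ t x * D.stressForm x (y + c • (x - x₀)) (y + c • (x - x₀)) := by
  have hX : Continuous fun x : 𝔼 => y + c • (x - x₀) := by fun_prop
  set K : ℝ := ‖y‖ + |c| * (1 + ‖x₀‖) with hK
  refine ((hg.integrable_mul_heatKernel x₀ ht 2).const_mul (n ^ 2 * K ^ 2)).mono'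
    ((contDiff_heatKernel x₀ t).continuous.mul
      (D.continuous_stressForm hX hX)).aestronglyMeasurable (ae_of_all _ fun x => ?_)
  have hw := (heatKernel_pos x₀ ht x).le
  have hf := D.curvatureNormSq_nonneg x
  have hXn := norm_add_smul_sub_le x₀ y c x
  rw [norm_mul, Real.norm_of_nonneg hw, Real.norm_eq_abs]
  calc _ ≤ heatKernel x₀ t x * (n ^ 2 * (D.curvatureNormSq x
          * ((K * (1 + ‖x‖)) * (K * (1 + ‖x‖))))) := by
        gcongr
        exact (D.abs_stressForm_le x _ _).trans (by gcongr)
    _ = _ := by ring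

/-- The first variation identity for the Gaussian weight and the linear field `y + c (x - x₀)`. -/
lemma IsSoliton.integral_heatKernel (hD : D.IsSoliton) (hg : D.HasPolynomialEnergyGrowth)
    (x₀ y : 𝔼) {t : ℝ} (ht : 0 < t) (c : ℝ) :
    ∫ x, heatKernel x₀ t x * (1 / 2 * D.stressForm x x (y + c • (x - x₀))
      + c * ((4 - n) / 4 * D.curvatureNormSq x)
      - 1 / (2 * t) * (D.stressForm x (x - x₀) (y + c • (x - x₀))
        - 1 / 4 * D.curvatureNormSq x * inner ℝ (x - x₀) (y + c • (x - x₀)))) = 0 := by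
  have hX : ContDiff ℝ 1 fun x : 𝔼 => y + c • (x - x₀) := by fun_prop
  have hXd : ∀ x, HasFDerivAt (fun x : 𝔼 => y + c • (x - x₀)) (c • ContinuousLinearMap.id ℝ 𝔼) x :=
    fun x => (((hasFDerivAt_id x).sub_const x₀).const_smul c).const_add y
  have hφ : ContDiff ℝ 1 fun x => heatKernel x₀ t x • (y + c • (x - x₀)) :=
    ((contDiff_heatKernel x₀ t).of_le (by norm_cast)).smul hX
  have hφd : ∀ x, fderiv ℝ (fun x => heatKernel x₀ t x • (y + c • (x - x₀))) x
      = heatKernel x₀ t x • c • ContinuousLinearMap.id ℝ 𝔼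
        + (-(heatKernel x₀ t x / (2 * t))) • (innerSL ℝ (x - x₀)).smulRight (y + c • (x - x₀)) :=
    fun x => by
      rw [((hasFDerivAt_heatKernel x₀ t x).fun_smul (hXd x)).fderiv]
      congr 1
      ext v : 1
      simp only [ContinuousLinearMap.smulRight_apply, smul_apply, smul_smul, smul_eq_mul]
  set K : ℝ := ‖y‖ + |c| * (1 + ‖x₀‖) with hK
  have hK0 : 0 ≤ K := by positivity
  have hXn := norm_add_smul_sub_le x₀ y c
  have hmain := hD.integral_stressPairing hφ
    (B := fun x => (K + |c| + (1 + ‖x₀‖) * K / (2 * t)) * ((1 + ‖x‖) ^ 2 * heatKernel x₀ t x)) ?_ ?_ ?_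
  · rw [← hmain]
    refine integral_congr_ae (ae_of_all _ fun x => ?_)
    simp only [hφd, stressForm_smul_right, stressPairing_add, stressPairing_smul, stressPairing_id,
      stressPairing_smulRight_inner]
    ring
  · simpa only [mul_left_comm (D.curvatureNormSq _)] using
      (hg.integrable_mul_heatKernel x₀ ht 2).const_mul (K + |c| + (1 + ‖x₀‖) * K / (2 * t))
  · intro x
    have hw := heatKernel_pos x₀ ht x
    rw [norm_smul, Real.norm_of_nonneg hw.le]
    calc (1 + ‖x‖) * (heatKernel x₀ t x * ‖y + c • (x - x₀)‖)
        ≤ (1 + ‖x‖) * (heatKernel x₀ t x * (K * (1 + ‖x‖))) := by gcongr; exact hXn x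
      _ = K * ((1 + ‖x‖) ^ 2 * heatKernel x₀ t x) := by ring
      _ ≤ _ := by
        refine mul_le_mul_of_nonneg_right ?_ (by positivity)
        rw [add_assoc]
        exact le_add_of_nonneg_right (by positivity)
  · intro x
    have hw := heatKernel_pos x₀ ht x
    rw [hφd]
    refine (norm_add_le _ _).trans ?_
    have h1 : ‖heatKernel x₀ t x • c • ContinuousLinearMap.id ℝ 𝔼‖
        ≤ |c| * ((1 + ‖x‖) ^ 2 * heatKernel x₀ t x) := by
      rw [norm_smul, norm_smul, Real.norm_of_nonneg hw.le, Real.norm_eq_abs]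
      have h2 := ContinuousLinearMap.norm_id_le (𝕜 := ℝ) (E := 𝔼)
      have h3 : (1 : ℝ) ≤ (1 + ‖x‖) ^ 2 := one_le_pow₀ (by simp)
      calc heatKernel x₀ t x * (|c| * ‖ContinuousLinearMap.id ℝ 𝔼‖)
          ≤ heatKernel x₀ t x * (|c| * (1 + ‖x‖) ^ 2) := by gcongr; exact h2.trans h3
        _ = _ := by ring
    have h2 : ‖(-(heatKernel x₀ t x / (2 * t))) • (innerSL ℝ (x - x₀)).smulRight (y + c • (x - x₀))‖
        ≤ (1 + ‖x₀‖) * K / (2 * t) * ((1 + ‖x‖) ^ 2 * heatKernel x₀ t x) := by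
      rw [norm_smul, ContinuousLinearMap.norm_smulRight_apply, innerSL_apply_norm, norm_neg,
        Real.norm_of_nonneg (by positivity)]
      calc heatKernel x₀ t x / (2 * t) * (‖x - x₀‖ * ‖y + c • (x - x₀)‖)
          ≤ heatKernel x₀ t x / (2 * t) * ((1 + ‖x₀‖) * (1 + ‖x‖) * (K * (1 + ‖x‖))) := by
            gcongr
            exacts [norm_sub_le_mul x x₀, hXn x]
        _ = _ := by ring
    have h3 : 0 ≤ K * ((1 + ‖x‖) ^ 2 * heatKernel x₀ t x) := by positivity
    linarith

/-- The derivative of the functional along the path `s ↦ (s y, 1 + a s²)`. -/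
theorem IsSoliton.hasDerivAt_realFunctional_path (hD : D.IsSoliton)
    (hg : D.HasPolynomialEnergyGrowth) (y : 𝔼) {a : ℝ} (ha : -1 < a) {s : ℝ}
    (hs : s ∈ Set.Ioo (0 : ℝ) 1) :
    HasDerivAt (fun s => D.realFunctional (s • y) (1 + a * s ^ 2))
      (-(2 * s * (1 + a * s ^ 2) ^ 2) * ∫ x, heatKernel (s • y) (1 + a * s ^ 2) x *
        D.stressForm x (y + (a * s / (1 + a * s ^ 2)) • (x - s • y))
          (y + (a * s / (1 + a * s ^ 2)) • (x - s • y))) s := by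
  have hcont : Continuous D.curvatureNormSq := D.contDiff_curvatureNormSq.continuous
  -- The interval `[τ, T]` contains every time `1 + a s²` on the path; `τ > 0` because `a > -1`.
  set τ : ℝ := min 1 (1 + a) with hτ
  set T : ℝ := max 1 (1 + a) with hT
  have hτ0 : 0 < τ := lt_min one_pos (by linarith)
  have hT0 : 0 < T := lt_max_of_lt_left one_pos
  have hτt : ∀ s ∈ Set.Ioo (0 : ℝ) 1, τ ≤ 1 + a * s ^ 2 := fun s hs => by
    have h1 : s ^ 2 ≤ 1 := pow_le_one₀ hs.1.le hs.2.le
    rcases le_total 0 a with h | h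
    · exact (min_le_left _ _).trans (by nlinarith [sq_nonneg s])
    · exact (min_le_right _ _).trans (by nlinarith)
  have htT : ∀ s ∈ Set.Ioo (0 : ℝ) 1, 1 + a * s ^ 2 ≤ T := fun s hs => by
    have h1 : s ^ 2 ≤ 1 := pow_le_one₀ hs.1.le hs.2.le
    rcases le_total 0 a with h | h
    · exact le_trans (by nlinarith) (le_max_right _ _)
    · exact le_trans (by nlinarith [sq_nonneg s]) (le_max_left _ _)
  have ht : 0 < 1 + a * s ^ 2 := hτ0.trans_le (hτt s hs)
  have hcw : ∀ s t : ℝ, Continuous fun x => D.curvatureNormSq x * (t ^ 2 * heatKernel (s • y) t x) :=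
    fun s t => hcont.mul (continuous_const.mul (contDiff_heatKernel _ _).continuous)
  -- Obtained by bounding `‖x - s y‖` by `q = (1 + ‖y‖)(1 + ‖x‖)`; as `q ≥ 1`, all terms are at most
  -- multiples of `q²`.
  set K : ℝ := (1 + ‖y‖) ^ 2 * (2 * |a| * (|(4 - n : ℝ) / 2| * T + 1 / 4) + T / 2 * ‖y‖) with hK
  have hbr : ∀ s ∈ Set.Ioo (0 : ℝ) 1, ∀ x : 𝔼,
      |2 * a * s * ((4 - n) / 2 * (1 + a * s ^ 2) + ‖x - s • y‖ ^ 2 / 4)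
          + (1 + a * s ^ 2) / 2 * inner ℝ (x - s • y) y| ≤ K * (1 + ‖x‖) ^ 2 := by
    intro s hs x
    have ht : 0 < 1 + a * s ^ 2 := hτ0.trans_le (hτt s hs)
    have hsy : ‖s • y‖ ≤ ‖y‖ := by
      rw [norm_smul, Real.norm_of_nonneg hs.1.le]
      exact mul_le_of_le_one_left (norm_nonneg _) hs.2.le
    set q : ℝ := (1 + ‖y‖) * (1 + ‖x‖) with hq
    have hq1 : 1 ≤ q := one_le_mul_of_one_le_of_one_le (by simp) (by simp)
    have hzq : ‖x - s • y‖ ≤ q := (norm_sub_le_mul x (s • y)).trans (by rw [hq]; gcongr)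
    have hqq : q ≤ q ^ 2 := by nlinarith
    have e1 : |(4 - n : ℝ) / 2 * (1 + a * s ^ 2) + ‖x - s • y‖ ^ 2 / 4|
        ≤ (|(4 - n : ℝ) / 2| * T + 1 / 4) * q ^ 2 := by
      refine (abs_add_le _ _).trans ?_
      rw [abs_mul, abs_of_pos ht, abs_of_nonneg (by positivity : 0 ≤ ‖x - s • y‖ ^ 2 / 4)]
      have h1 : |(4 - n : ℝ) / 2| * (1 + a * s ^ 2) ≤ |(4 - n : ℝ) / 2| * T * q ^ 2 :=
        (mul_le_mul_of_nonneg_left (htT s hs) (abs_nonneg _)).trans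
          (le_mul_of_one_le_right (by positivity) (one_le_pow₀ hq1))
      have h2 : ‖x - s • y‖ ^ 2 ≤ q ^ 2 := by gcongr
      linarith
    have e2 : |2 * a * s| ≤ 2 * |a| := by
      rw [abs_mul, abs_mul, abs_two, abs_of_pos hs.1]
      exact mul_le_of_le_one_right (by positivity) hs.2.le
    have e3 : |(1 + a * s ^ 2) / 2 * inner ℝ (x - s • y) y| ≤ T / 2 * ‖y‖ * q ^ 2 := by
      rw [abs_mul, abs_of_pos (half_pos ht)]
      have h1 := htT s hs
      calc _ ≤ T / 2 * (q ^ 2 * ‖y‖) := by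
            gcongr
            exact (abs_real_inner_le_norm _ _).trans (by gcongr; exact hzq.trans hqq)
        _ = _ := by ring
    refine (abs_add_le _ _).trans ?_
    rw [abs_mul]
    have e4 := mul_le_mul e2 e1 (abs_nonneg _) (by positivity)
    have e5 : K * (1 + ‖x‖) ^ 2 = (2 * |a| * (|(4 - n : ℝ) / 2| * T + 1 / 4) + T / 2 * ‖y‖) * q ^ 2 := by
      rw [hK, hq]
      ring
    linarith
  have hmain := hasDerivAt_integral_of_dominated_loc_of_deriv_le (μ := volume)
    (F := fun s x => D.curvatureNormSq x * ((1 + a * s ^ 2) ^ 2 * heatKernel (s • y) (1 + a * s ^ 2) x))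
    (F' := fun s x => D.curvatureNormSq x * (heatKernel (s • y) (1 + a * s ^ 2) x *
        (2 * a * s * ((4 - n) / 2 * (1 + a * s ^ 2) + ‖x - s • y‖ ^ 2 / 4)
          + (1 + a * s ^ 2) / 2 * inner ℝ (x - s • y) y)))
    (bound := fun x => K * ((4 * Real.pi * τ) ^ (-(n : ℝ) / 2) * Real.exp (‖y‖ ^ 2 / (4 * T))) *
      (D.curvatureNormSq x * ((1 + ‖x‖) ^ 2 * Real.exp (-(1 / (8 * T)) * ‖x‖ ^ 2))))
    (Ioo_mem_nhds hs.1 hs.2)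
    (Eventually.of_forall fun s => (hcw s _).aestronglyMeasurable) ?_ ?_ ?_
    ((hg.integrable_mul_pow_mul_exp (by positivity) 2).const_mul _) ?_
  · obtain ⟨hint, hder⟩ := hmain
    refine hder.congr_deriv ?_
    set t : ℝ := 1 + a * s ^ 2 with ht_def
    set c : ℝ := a * s / t with hc
    have hct : c * t = a * s := div_mul_cancel₀ _ ht.ne'
    have h0 := hD.integral_heatKernel hg (s • y) y ht c
    have hS := hg.integrable_heatKernel_mul_stressForm (s • y) y ht c
    -- The first variation integrand is `1 / (4t²)` times the derivative of the weighted integrand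
    -- plus `2 s t²` times the kernel times `S(X, X)`.
    have hpt : ∀ x : 𝔼, heatKernel (s • y) t x * (1 / 2 * D.stressForm x x (y + c • (x - s • y))
        + c * ((4 - n) / 4 * D.curvatureNormSq x)
        - 1 / (2 * t) * (D.stressForm x (x - s • y) (y + c • (x - s • y))
          - 1 / 4 * D.curvatureNormSq x * inner ℝ (x - s • y) (y + c • (x - s • y))))
        = 1 / (4 * t ^ 2) * (D.curvatureNormSq x * (heatKernel (s • y) t x *
          (2 * a * s * ((4 - n) / 2 * t + ‖x - s • y‖ ^ 2 / 4) + t / 2 * inner ℝ (x - s • y) y))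
          + 2 * s * t ^ 2 * (heatKernel (s • y) t x
            * D.stressForm x (y + c • (x - s • y)) (y + c • (x - s • y)))) := by
      intro x
      -- This is `z = t x - s t X`; it holds because `s t c = a s² = t - 1`, and it is what makes
      -- the choice of `c` cancel the mixed terms.
      have hz : x - s • y = t • x + (-(s * t)) • (y + c • (x - s • y)) := by
        have h1 : s * t * c = t - 1 := by
          rw [mul_assoc, mul_comm t, hct, ht_def]
          ring
        rw [smul_add, smul_smul, neg_mul, h1]
        module
      have hform : D.stressForm x (x - s • y) (y + c • (x - s • y))
          = t * D.stressForm x x (y + c • (x - s • y))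
            - s * t * D.stressForm x (y + c • (x - s • y)) (y + c • (x - s • y)) := by
        conv_lhs => rw [hz]
        rw [stressForm_add_left, stressForm_smul_left, stressForm_smul_left, ← hz]
        ring
      have hin : inner ℝ (x - s • y) (y + c • (x - s • y))
          = inner ℝ (x - s • y) y + c * ‖x - s • y‖ ^ 2 := by
        rw [inner_add_right, inner_smul_right, real_inner_self_eq_norm_sq]
      rw [hform, hin, mul_assoc 2 a s, ← hct]
      field_simp
      ring
    simp only [hpt] at h0
    rw [integral_const_mul, integral_add hint (hS.const_mul _), integral_const_mul] at h0
    have h1 := (mul_eq_zero.1 h0).resolve_left (by positivity)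
    linarith
  · have := (hg.integrable_mul_heatKernel (s • y) ht 0).const_mul ((1 + a * s ^ 2) ^ 2)
    simpa only [pow_zero, one_mul, mul_left_comm ((1 + a * s ^ 2) ^ 2)] using this
  · exact (hcont.mul ((contDiff_heatKernel _ _).continuous.mul
      (by fun_prop))).aestronglyMeasurable
  · refine ae_of_all _ fun x s hs => ?_
    have ht : 0 < 1 + a * s ^ 2 := hτ0.trans_le (hτt s hs)
    have hf := D.curvatureNormSq_nonneg x
    have hw := heatKernel_pos (s • y) ht x
    have hsy : ‖s • y‖ ≤ ‖y‖ := by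
      rw [norm_smul, Real.norm_of_nonneg hs.1.le]
      exact mul_le_of_le_one_left (norm_nonneg _) hs.2.le
    have hle := heatKernel_le hτ0 (hτt s hs) (htT s hs) hsy x
    rw [norm_mul, norm_mul, Real.norm_of_nonneg hf, Real.norm_of_nonneg hw.le, Real.norm_eq_abs]
    calc _ ≤ D.curvatureNormSq x * (((4 * Real.pi * τ) ^ (-(n : ℝ) / 2)
            * Real.exp (‖y‖ ^ 2 / (4 * T)) * Real.exp (-(1 / (8 * T)) * ‖x‖ ^ 2))
            * (K * (1 + ‖x‖) ^ 2)) :=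
          mul_le_mul_of_nonneg_left (mul_le_mul hle (hbr s hs x) (abs_nonneg _) (by positivity)) hf
      _ = _ := by ring
  · exact ae_of_all _ fun x s hs =>
      (hasDerivAt_heatKernel_path y x a (hτ0.trans_le (hτt s hs))).const_mul _

/-! ### Rigidity when the derivative vanishes. -/

/-- If a linear vector field `y + c (x - x₀)` which does not vanish identically is in the kernel of
the curvature of a soliton, then the soliton is cylindrical. -/
theorem IsSoliton.isCylindrical_of_stressForm_eq_zero (hn : 1 ≤ n) (hD : D.IsSoliton) {x₀ y : 𝔼}
    {c : ℝ} (hyc : y ≠ 0 ∨ c ≠ 0)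
    (h : ∀ x, D.stressForm x (y + c • (x - x₀)) (y + c • (x - x₀)) = 0) : D.IsCylindrical := by
  by_cases hc : c = 0
  · subst hc
    simp only [zero_smul, add_zero] at h
    exact ⟨y, by simpa using hyc, fun x j => D.contractCurvature_eq_zero (h x) j⟩
  have hdf : Differentiable ℝ D.curvatureNormSq :=
    D.contDiff_curvatureNormSq.differentiable (by simp)
  have hX : ∀ x i, HasFDerivAt (fun x : 𝔼 => (y + c • (x - x₀)) i)
      (c • (EuclideanSpace.proj i : 𝔼 →L[ℝ] ℝ)) x := fun x i => by
    have h1 : HasFDerivAt (fun x : 𝔼 => y + c • (x - x₀)) (c • ContinuousLinearMap.id ℝ 𝔼) x :=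
      (((hasFDerivAt_id x).sub_const x₀).const_smul c).const_add y
    refine ((EuclideanSpace.proj (𝕜 := ℝ) i).hasFDerivAt.comp x h1).congr_fderiv ?_
    ext v
    simp
  have hhom : ∀ x, fderiv ℝ D.curvatureNormSq x (y + c • (x - x₀)) = -4 * c * D.curvatureNormSq x := by
    intro x
    have hrow : ∀ i x, ∑ j, D.stress i j x * (y + c • (x - x₀)) j = 0 := fun i x => by
      have := D.stressForm_left_eq_zero (h x) (EuclideanSpace.single i 1)
      simpa [stressForm, Finset.sum_comm (γ := Fin n)] using this
    -- Differentiate `∑ⱼ Sᵢⱼ Xⱼ = 0` in direction `i`; since `∂ᵢXⱼ = c δᵢⱼ`, summing over `i` gives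
    -- `(div S)(X) + c |F|² = 0`.
    have hdiff : ∀ i, ∑ j, (fderiv ℝ (D.stress i j) x (EuclideanSpace.single i 1)
        * (y + c • (x - x₀)) j) + c * D.stress i i x = 0 := fun i => by
      have h1 : HasFDerivAt (fun x => ∑ j, D.stress i j x * (y + c • (x - x₀)) j) _ x :=
        HasFDerivAt.fun_sum (u := Finset.univ) fun j _ =>
          (((D.contDiff_stress i j).differentiable (by simp)) x).hasFDerivAt.fun_mul (hX x j)
      simp only [hrow] at h1
      have h2 := congrArg (fun L : 𝔼 →L[ℝ] ℝ => L (EuclideanSpace.single i 1))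
        (h1.unique (hasFDerivAt_const 0 x))
      simp only [_root_.sum_apply, add_apply, smul_apply, smul_eq_mul, Finset.sum_add_distrib] at h2
      rw [add_comm] at h2
      simpa [Pi.single_apply, mul_comm] using h2
    have hsum : ∑ j, (∑ i, fderiv ℝ (D.stress i j) x (EuclideanSpace.single i 1))
        * (y + c • (x - x₀)) j + c * D.curvatureNormSq x = 0 := by
      have := Finset.sum_eq_zero fun i (_ : i ∈ Finset.univ) => hdiff i
      rw [Finset.sum_add_distrib, ← Finset.mul_sum, Finset.sum_comm] at this
      simpa only [Finset.sum_mul, curvatureNormSq_eq_sum_stress] using this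
    have hS : ∑ j, (∑ l, x l * D.stress l j x) * (y + c • (x - x₀)) j = 0 := by
      rw [← D.stressForm_left_eq_zero (h x) x, stressForm, Finset.sum_comm]
      simp only [Finset.sum_mul, mul_comm (x _)]
    have hgrad : fderiv ℝ D.curvatureNormSq x (y + c • (x - x₀))
        = ∑ j, fderiv ℝ D.curvatureNormSq x (EuclideanSpace.single j 1) * (y + c • (x - x₀)) j := by
      conv_lhs => rw [← (EuclideanSpace.basisFun (Fin n) ℝ).sum_repr (y + c • (x - x₀))]
      simp [map_sum, mul_comm]
    simp only [hD.sum_fderiv_stress, add_mul, Finset.sum_add_distrib, mul_assoc,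
      ← Finset.mul_sum, hS, ← hgrad] at hsum
    linarith
  have hzero : ∀ x, D.curvatureNormSq x = 0 := by
    intro x
    -- The zero of `X`. Along rays from it `ρ⁴ |F|²` is constant, and its value at `ρ = 0` is zero.
    set x₁ : 𝔼 := x₀ - c⁻¹ • y with hx₁
    have hcen : ∀ (ρ : ℝ) (v : 𝔼), y + c • (x₁ + ρ • v - x₀) = (c * ρ) • v := fun ρ v => by
      rw [hx₁]
      have : x₀ - c⁻¹ • y + ρ • v - x₀ = ρ • v - c⁻¹ • y := by abel
      rw [this, smul_sub, smul_smul, smul_smul, mul_inv_cancel₀ hc, one_smul]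
      abel
    have hder : ∀ ρ : ℝ, HasDerivAt (fun ρ : ℝ => ρ ^ 4 * D.curvatureNormSq (x₁ + ρ • (x - x₁)))
        0 ρ := fun ρ => by
      have h1 : HasDerivAt (fun ρ : ℝ => x₁ + ρ • (x - x₁)) (x - x₁) ρ := by
        simpa using ((hasDerivAt_id ρ).smul_const (x - x₁)).const_add x₁
      have h2 := (hdf (x₁ + ρ • (x - x₁))).hasFDerivAt.comp_hasDerivAt ρ h1
      refine ((hasDerivAt_pow 4 ρ).mul h2).congr_deriv ?_
      have h3 := hhom (x₁ + ρ • (x - x₁))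
      rw [hcen, map_smul, smul_eq_mul, mul_assoc, mul_assoc, mul_left_comm (-4 : ℝ)] at h3
      have h4 := mul_left_cancel₀ hc h3
      simp only [Function.comp_apply]
      linear_combination ρ ^ 3 * h4
    have hconst := is_const_of_deriv_eq_zero (fun ρ => (hder ρ).differentiableAt)
      (fun ρ => (hder ρ).deriv) 1 0
    simpa using hconst
  -- For a flat connection any nonzero vector will do, and `n ≥ 1` provides one.
  refine ⟨EuclideanSpace.single ⟨0, hn⟩ 1, by simp, fun x j => D.contractCurvature_eq_zero ?_ j⟩
  refine abs_nonpos_iff.1 ((D.abs_stressForm_le x _ _).trans ?_)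
  simp [hzero x]

end MetricConnection
end YangMills

/-! ### Strict monotonicity, the entropy and the uniform gap. -/

namespace YangMills

open MeasureTheory Filter Topology

variable {n r : ℕ}

local notation "𝔼" => EuclideanSpace ℝ (Fin n)

namespace MetricConnection

variable {D : MetricConnection n r}

/-- The functional of a noncylindrical soliton decreases along `s ↦ (s y, 1 + a s²)`. -/
theorem IsSoliton.strictAntiOn_realFunctional_path (hn : 1 ≤ n) (hD : D.IsSoliton)
    (hg : D.HasPolynomialEnergyGrowth) (hcyl : ¬D.IsCylindrical) {y : 𝔼} {a : ℝ} (ha : -1 < a)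
    (hya : y ≠ 0 ∨ a ≠ 0) :
    StrictAntiOn (fun s : ℝ => D.realFunctional (s • y) (1 + a * s ^ 2)) (Set.Icc 0 1) := by
  have hpos : ∀ s ∈ Set.Icc (0 : ℝ) 1, 0 < 1 + a * s ^ 2 := fun s hs => by
    have h1 : s ^ 2 ≤ 1 := pow_le_one₀ hs.1 hs.2
    rcases le_total 0 a with h | h <;> nlinarith [sq_nonneg s]
  -- A negative derivative is needed only on the open interval, which matters as the factor `s` in
  -- the derivative formula degenerates at `s = 0`.
  refine strictAntiOn_of_deriv_neg (convex_Icc 0 1) (fun s hs => ?_) fun s hs => ?_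
  · refine ContinuousAt.continuousWithinAt ?_
    exact (hg.continuousAt_realFunctional (s • y) (hpos s hs)).comp
      (f := fun s : ℝ => (s • y, 1 + a * s ^ 2)) (by fun_prop)
  · rw [interior_Icc] at hs
    have ht := hpos s (Set.Ioo_subset_Icc_self hs)
    rw [(hD.hasDerivAt_realFunctional_path hg y ha hs).deriv]
    have hyc : y ≠ 0 ∨ a * s / (1 + a * s ^ 2) ≠ 0 :=
      hya.imp_right fun h => div_ne_zero (mul_ne_zero h hs.1.ne') ht.ne'
    obtain ⟨x, hx⟩ : ∃ x, D.stressForm x (y + (a * s / (1 + a * s ^ 2)) • (x - s • y))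
        (y + (a * s / (1 + a * s ^ 2)) • (x - s • y)) ≠ 0 := by
      by_contra! h
      exact hcyl (hD.isCylindrical_of_stressForm_eq_zero hn hyc h)
    have hint := integral_pos_of_integrable_nonneg_nonzero (μ := volume) (x := x)
      ((contDiff_heatKernel _ _).continuous.mul
        (D.continuous_stressForm (by fun_prop) (by fun_prop)))
      (hg.integrable_heatKernel_mul_stressForm (s • y) y ht (a * s / (1 + a * s ^ 2)))
      (fun x => mul_nonneg (heatKernel_pos _ ht x).le (D.stressForm_self_nonneg x _))
      (mul_ne_zero (heatKernel_pos _ ht x).ne' hx)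
    have hs0 := hs.1
    exact mul_neg_of_neg_of_pos (neg_neg_of_pos (by positivity)) hint

lemma IsSoliton.realFunctional_lt (hn : 1 ≤ n) (hD : D.IsSoliton)
    (hg : D.HasPolynomialEnergyGrowth) (hcyl : ¬D.IsCylindrical) {x₀ : 𝔼} {t₀ : ℝ} (ht₀ : 0 < t₀)
    (h : x₀ ≠ 0 ∨ t₀ ≠ 1) : D.realFunctional x₀ t₀ < D.realFunctional 0 1 := by
  have := hD.strictAntiOn_realFunctional_path hn hg hcyl (y := x₀) (a := t₀ - 1) (by linarith)
    (h.imp_right sub_ne_zero.2) (Set.left_mem_Icc.2 zero_le_one) (Set.right_mem_Icc.2 zero_le_one)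
    zero_lt_one
  simpa using this

/-- Away from `(0, 1)` the functional is bounded away from its value at `(0, 1)`. -/
lemma IsSoliton.exists_realFunctional_le (hn : 1 ≤ n) (hD : D.IsSoliton)
    (hg : D.HasPolynomialEnergyGrowth) (hcyl : ¬D.IsCylindrical) {ε : ℝ} (hε : 0 < ε) :
    ∃ M, 0 ≤ M ∧ M < D.realFunctional 0 1 ∧ ∀ (x₀ : 𝔼) (t₀ : ℝ), 0 < t₀ →
      ε < ‖x₀‖ + |Real.log t₀| → D.realFunctional x₀ t₀ ≤ M := by
  -- The second coordinate is `log t`, so that closed and bounded means compact without reaching `t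
  -- = 0`.
  set K : Set (𝔼 × ℝ) := {p | ‖p.1‖ + |p.2| = ε} with hK
  have hKc : IsCompact K := by
    refine Metric.isCompact_of_isClosed_isBounded
      (isClosed_eq (by fun_prop) continuous_const) ?_
    refine (Metric.isBounded_closedBall (x := (0 : 𝔼 × ℝ)) (r := ε)).subset fun p hp => ?_
    have hp' : ‖p.1‖ + |p.2| = ε := hp
    rw [mem_closedBall_zero_iff, Prod.norm_def, Real.norm_eq_abs]
    exact max_le (by linarith [abs_nonneg p.2]) (by linarith [norm_nonneg p.1])
  have hcont : Continuous fun p : 𝔼 × ℝ => D.realFunctional p.1 (Real.exp p.2) :=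
    continuous_iff_continuousAt.2 fun p =>
      (hg.continuousAt_realFunctional p.1 (Real.exp_pos p.2)).comp
        (f := fun p : 𝔼 × ℝ => (p.1, Real.exp p.2)) (by fun_prop)
  obtain ⟨q, hqK, hq⟩ := hKc.exists_isMaxOn
    (⟨(0, ε), by simp [hK, abs_of_pos hε]⟩ : K.Nonempty) hcont.continuousOn
  refine ⟨D.realFunctional q.1 (Real.exp q.2), realFunctional_nonneg _ (Real.exp_pos _),
    hD.realFunctional_lt hn hg hcyl (Real.exp_pos _) ?_, fun x₀ t₀ ht₀ h => ?_⟩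
  · by_contra! h
    have h2 : q.2 = 0 := Real.exp_eq_one_iff _ |>.1 h.2
    have : ‖q.1‖ + |q.2| = ε := hqK
    rw [h.1, h2] at this
    simp at this
    exact hε.ne this
  have hpos : ∀ s ∈ Set.Icc (0 : ℝ) 1, 0 < 1 + (t₀ - 1) * s ^ 2 := fun s hs => by
    have h1 : s ^ 2 ≤ 1 := pow_le_one₀ hs.1 hs.2
    rcases le_total 1 t₀ with h | h <;> nlinarith [sq_nonneg s]
  have hpath : ContinuousOn (fun s : ℝ => ‖s • x₀‖ + |Real.log (1 + (t₀ - 1) * s ^ 2)|)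
      (Set.Icc 0 1) := by
    refine ContinuousOn.add (by fun_prop) (ContinuousOn.abs (ContinuousOn.log (by fun_prop) ?_))
    exact fun s hs => (hpos s hs).ne'
  -- The path starts at `(0, 1)`, where the distance function is zero, and ends beyond `ε`; the
  -- crossing point lies in `K`.
  obtain ⟨s, hs, hsε⟩ := intermediate_value_Icc zero_le_one hpath
    (show ε ∈ _ from ⟨by simpa using hε.le, by simpa using h.le⟩)
  have hne : x₀ ≠ 0 ∨ t₀ ≠ 1 := by
    by_contra! h'
    rw [h'.1, h'.2] at h
    simp at h
    linarith
  have hanti := (hD.strictAntiOn_realFunctional_path hn hg hcyl (y := x₀) (a := t₀ - 1)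
    (by linarith) (hne.imp_right sub_ne_zero.2)).antitoneOn hs (Set.right_mem_Icc.2 zero_le_one) hs.2
  have hmem : (s • x₀, Real.log (1 + (t₀ - 1) * s ^ 2)) ∈ K := hsε
  have hmax := hq hmem
  simp only [Set.mem_ofPred_eq, Real.exp_log (hpos s hs)] at hmax
  simp only [one_smul, one_pow, mul_one, add_sub_cancel] at hanti
  exact hanti.trans hmax

lemma IsSoliton.entropy_eq (hn : 1 ≤ n) (hD : D.IsSoliton)
    (hg : D.HasPolynomialEnergyGrowth) (hcyl : ¬D.IsCylindrical) :
    D.entropy = ENNReal.ofReal (D.realFunctional 0 1) := by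
  refine le_antisymm (sSup_le ?_) (le_sSup ⟨0, 1, one_pos, (hg.functional_eq 0 one_pos).symm⟩)
  rintro _ ⟨x₀, t₀, ht₀, rfl⟩
  rw [hg.functional_eq x₀ ht₀]
  refine ENNReal.ofReal_le_ofReal ?_
  by_cases h : x₀ ≠ 0 ∨ t₀ ≠ 1
  · exact (hD.realFunctional_lt hn hg hcyl ht₀ h).le
  · push Not at h
    rw [h.1, h.2]

end MetricConnection

end YangMills

end

theorem mainTheorem5 {n r : ℕ} (hn : 1 ≤ n) (D : YangMills.MetricConnection n r)
    (hsol : D.IsSoliton) (hgrowth : D.HasPolynomialEnergyGrowth) (hcyl : ¬ D.IsCylindrical) :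
    D.entropy ≠ ⊤ ∧
    (∀ ε : ℝ, 0 < ε → ∃ δ : ℝ, 0 < δ ∧
      sSup {a : ℝ≥0∞ | ∃ (x₀ : EuclideanSpace ℝ (Fin n)) (t₀ : ℝ),
          0 < t₀ ∧ ε < ‖x₀‖ + |Real.log t₀| ∧ a = D.functional x₀ t₀}
        < D.entropy - ENNReal.ofReal δ) ∧
    (∀ (x₀ : EuclideanSpace ℝ (Fin n)) (t₀ : ℝ), 0 < t₀ →
      (D.functional x₀ t₀ = D.entropy ↔ x₀ = 0 ∧ t₀ = 1)) := by
  have hent := hsol.entropy_eq hn hgrowth hcyl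
  refine ⟨by rw [hent]; exact ENNReal.ofReal_ne_top, fun ε hε => ?_, fun x₀ t₀ ht₀ => ?_⟩
  · obtain ⟨M, hM0, hM, hle⟩ := hsol.exists_realFunctional_le hn hgrowth hcyl hε
    -- Half of the gap, so that the strict inequality survives taking the supremum.
    refine ⟨(D.realFunctional 0 1 - M) / 2, by linarith, ?_⟩
    rw [hent, ← ENNReal.ofReal_sub _ (by linarith)]
    refine lt_of_le_of_lt (b := ENNReal.ofReal M) (sSup_le ?_)
      ((ENNReal.ofReal_lt_ofReal_iff (by linarith)).2 (by linarith))
    rintro _ ⟨x₀, t₀, ht₀, h, rfl⟩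
    rw [hgrowth.functional_eq x₀ ht₀]
    exact ENNReal.ofReal_le_ofReal (hle x₀ t₀ ht₀ h)
  · rw [hent, hgrowth.functional_eq x₀ ht₀]
    refine ⟨fun h => ?_, fun h => by rw [h.1, h.2]⟩
    by_contra hne
    have hlt := hsol.realFunctional_lt hn hgrowth hcyl ht₀ (not_and_or.1 hne)
    -- `ENNReal.ofReal` preserves a strict inequality only when the larger side is positive.
    have hpos := (YangMills.MetricConnection.realFunctional_nonneg x₀ ht₀).trans_lt hlt
    exact (ENNReal.ofReal_lt_ofReal_iff hpos |>.2 hlt).ne h
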